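/- **Linear BTK algorithm.** For nonnegative integers $k_1,\dots,k_n$ let $M(n,k_1,\dots,k_n)=\{x\in\mathbb N^n : x_i\le k_i\}$, ordered componentwise, with rank $x_1+\cdots+x_n$, and let $V(P)$ be the complex vector space with basis $P$. The algorithm produces a set of chains (finite sequences) of integral vectors of $V(M(n,k_1,\dots,k_n))$. *Pairs.* For $M(2,p,q)$ with $p=0$ or $q=0$ it produces the single chain of all points of the poset. For $p,q\ge1$ it produces the chain $(v(0),\dots,v(p+q))$ with $v(l)=\sum_{i+j=l,\ 0\le i\le p,\ 0\le j\le q}\binom{l}{i}(i,j)$, together with the images of the chains produced for $M(2,p-1,q-1)$ under the linear map $(i,j)\mapsto v(i,j+1)$, where $v(i,j)=(p-i)(i,j)-(q-j+1)(i+1,j-1)$ for $0\le i\le p-1$, $1\le j\le q$. *General case.* For $n=0$ it produces the one-vector chain consisting of the only point. For $M(n+1,k_1,\dots,k_{n+1})$, take each chain $(x_0,\dots,x_l)$ produced for $M(n,k_1,\dots,k_n)$, write $R_j$ for the linear map $(a_1,\dots,a_n)\mapsto(a_1,\dots,a_n,j)$, and take the images of the chains produced for $M(2,l,k_{n+1})$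 under the linear map $(i,j)\mapsto R_j(x_i)$. The output consists of all the chains so obtained. Let $B(n)=M(n,1,\dots,1)$, identified with the set of subsets of $\{1,\dots,n\}$, and let $O(n)$ be the set of all vectors in the chains produced for $B(n)$. **Notation.** Let $n\ge0$ be an integer, $m=\lfloor n/2\rfloor$, and for $0\le k\le m$ put $p_k=n-2k+1$ and $q_k=\binom nk-\binom n{k-1}$ (with $\binom n{-1}=0$). The Terwilliger algebra $\mathcal A_n$ of the binary Hamming scheme is the $*$-algebra of complex $B(n)\times B(n)$ matrices $M$ with $M(\pi(X),\pi(Y))=M(X,Y)$ for all $X,Y\in B(n)$ and $\pi\in S_n$. For nonnegative integers $i,j,t$, $M^t_{i,j}\in\mathcal A_n$ is the matrix with entry $1$ at $(X,Y)$ if $|X|=i$, $|Y|=j$, $|X\cap Y|=t$, and $0$ otherwise. Let $$\beta^t_{i,j,k}=\sum_{u=0}^n(-1)^{u-t}\binom ut\binom{n-2k}{u-k}\binom{n-k-u}{i-u}\binom{n-k-u}{j-u},$$ where $\binom ab=0$ for $b<0$. For $k\le i,j\le n-k$ let $E_{i,j,k}$ be the $p_k\times p_k$ matrix, with rows and columns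 indexed by $k,k+1,\dots,n-k$, whose $(i,j)$ entry is $1$ and whose other entries are $0$. **Theorem.** For every $0\le k\le m$ there are exactly $q_k$ chains in $O(n)$ starting at rank $k$ and ending at rank $n-k$. Fix any ordering of these chains, for every $k$. Then the vectors of $O(n)$ are indexed bijectively by the set $S$ of triples $(k,b,i)$ with $0\le k\le m$, $1\le b\le q_k$, $k\le i\le n-k$: the vector with index $(k,b,i)$ is the one of rank $i$ on the $b$-th chain from rank $k$ to rank $n-k$. Let $N(n)$ be the real $B(n)\times S$ matrix whose columns are the vectors of $O(n)$, each divided by its Euclidean length. Then: 1. $N(n)$ is unitary, and $N(n)^*\mathcal A_nN(n)$ is exactly the set of block diagonal $S\times S$ matrices in which, for each $0\le k\le m$, one and the same $p_k\times p_k$ block $B_k$, an arbitrary complex matrix with rows and columns indexed by $k,\dots,n-k$, is repeated $q_k$ times (once for each $b$). 2. The map $\Phi$ given by conjugation $M\mapsto N(n)^*MN(n)$ followed by dropping the repeated blocks is an isomorphism of $*$-algebras $\Phi:\mathcal A_n\to\bigoplus_{k=0}^{m}\mathrm{Mat}(p_k\times p_k)$. 3. Let $i,j,t\in\{0,\dots,n\}$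 and write $\Phi(M^t_{i,j})=(N_0,\dots,N_m)$. Then, for $0\le k\le m$, $$N_k=\begin{cases}\binom{n-2k}{i-k}^{-1/2}\binom{n-2k}{j-k}^{-1/2}\,\beta^t_{i,j,k}\,E_{i,j,k}&\text{if }k\le i,j\le n-k,\\0&\text{otherwise.}\end{cases}$$ -/

import Mathlib

/-! ## The linear BTK algorithm on a product of chains

A vector of `V(M(2,p,q))` is given by its integer coordinates `w i j` at the points `(i, j)`,
a vector of `V(M(n,k₁,…,kₙ))` by its integer coordinates at the points `a : Fin n → ℕ`;
coordinates outside the poset are zero.  A symmetric Jordan basis is given as the list of its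
Jordan chains, and each chain as the list of its vectors, by increasing rank. -/

/-- The basis vector `(a, b)`. -/
def pairUnit (a b : ℕ) : ℕ → ℕ → ℤ := fun i j => if i = a ∧ j = b then 1 else 0

/-- The vector `v(k) = U^k((0,0)) = ∑_{i+j=k} (k choose i) (i, j)` of `V(M(2,p,q))`. -/
def pairMain (p q k : ℕ) : ℕ → ℕ → ℤ :=
  fun i j => if i ≤ p ∧ j ≤ q ∧ i + j = k then (k.choose i : ℤ) else 0

/-- The vector `v(i,j) = (p-i) (i, j) - (q-j+1) (i+1, j-1)`, for `0 ≤ i ≤ p-1`, `1 ≤ j ≤ q`. -/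
def pairVec (p q i j : ℕ) : ℕ → ℕ → ℤ :=
  ((p : ℤ) - i) • pairUnit i j - ((q : ℤ) - j + 1) • pairUnit (i + 1) (j - 1)

/-- The linear map `V(M(2,p,q)) → V(M(2,p+1,q+1))` with `(i, j) ↦ v(i, j+1)`. -/
def pairTransfer (p q : ℕ) (w : ℕ → ℕ → ℤ) : ℕ → ℕ → ℤ :=
  ∑ i ∈ Finset.range (p + 1), ∑ j ∈ Finset.range (q + 1), w i j • pairVec (p + 1) (q + 1) i (j + 1)

/-- The symmetric Jordan chains of `V(M(2,p,q))` that the algorithm produces. -/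
def pairBTK : ℕ → ℕ → List (List (ℕ → ℕ → ℤ))
  | 0, q => [(List.range (q + 1)).map fun j => pairUnit 0 j]
  | p + 1, 0 => [(List.range (p + 2)).map fun i => pairUnit i 0]
  | p + 1, q + 1 =>
      (List.range (p + q + 3)).map (pairMain (p + 1) (q + 1)) ::
        (pairBTK p q).map (List.map (pairTransfer p q))

/-- The copy in the layer `aₙ₊₁ = j` of a vector of `V(M(n,k₁,…,kₙ))`. -/
def layerCopy {n : ℕ} (j : ℕ) (v : (Fin n → ℕ) → ℤ) : (Fin (n + 1) → ℕ) → ℤ :=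
  fun a => if a (Fin.last n) = j then v (fun i => a i.castSucc) else 0

/-- For a chain `x = (x₀,…,x_l)`, the linear map that sends the point `(i, j)` of `M(2,l,q)` to the
copy of `x_i` in the layer `j`. -/
def chainMap {n : ℕ} (q : ℕ) (x : List ((Fin n → ℕ) → ℤ)) (w : ℕ → ℕ → ℤ) :
    (Fin (n + 1) → ℕ) → ℤ :=
  ∑ i ∈ Finset.range x.length, ∑ j ∈ Finset.range (q + 1), w i j • layerCopy j (x.getD i 0)

/-- The linear BTK algorithm: the symmetric Jordan chains it produces for `V(M(n,k₁,…,kₙ))`.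
Every chain `(x₀,…,x_l)` of the basis for the first coordinates spans, with its copies in the
layers, a space that looks like `V(M(2,l,kₙ₊₁))`, whose chains are carried over. -/
def linearBTK : (n : ℕ) → (Fin n → ℕ) → List (List ((Fin n → ℕ) → ℤ))
  | 0, _ => [[fun _ => 1]]
  | n + 1, k =>
      (linearBTK n fun i => k i.castSucc).flatMap fun x =>
        (pairBTK (x.length - 1) (k (Fin.last n))).map (List.map (chainMap (k (Fin.last n)) x))

/-! ## The Boolean algebra -/

/-- The chains of `O(n)`: the output of the linear BTK algorithm on `B(n) = M(n,1,…,1)`, with the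
points of `B(n)` regarded as subsets of an `n`-element set. -/
def boolChains (n : ℕ) : List (List (Finset (Fin n) → ℤ)) :=
  (linearBTK n fun _ => 1).map (List.map fun v X => v fun i => if i ∈ X then 1 else 0)

/-- `v` is a nonzero homogeneous vector of `V(B(n))`, of rank `r`. -/
def HasRank {n : ℕ} (v : Finset (Fin n) → ℤ) (r : ℕ) : Prop :=
  v ≠ 0 ∧ ∀ X, v X ≠ 0 → X.card = r

instance {n : ℕ} (v : Finset (Fin n) → ℤ) (r : ℕ) : Decidable (HasRank v r) :=
  inferInstanceAs (Decidable (v ≠ 0 ∧ ∀ X, v X ≠ 0 → X.card = r))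

/-- The chains of `O(n)` that start at rank `k` and end at rank `n - k`. -/
def chainsFrom (n k : ℕ) : List (List (Finset (Fin n) → ℤ)) :=
  (boolChains n).filter fun c => HasRank (c.headD 0) k ∧ HasRank (c.getLastD 0) (n - k)

/-- `q_k = (n choose k) - (n choose k-1)`, where `(n choose -1) = 0`. -/
def chainCount (n k : ℕ) : ℕ := n.choose k - if k = 0 then 0 else n.choose (k - 1)

theorem chainCount_pos {n k : ℕ} (hk : k ≤ n / 2) : 0 < chainCount n k := by
  unfold chainCount
  rcases k with _ | k
  · simp
  · have h1 := Nat.choose_succ_right_eq n k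
    have h2 : 0 < n.choose k := Nat.choose_pos (by omega)
    have h3 : n.choose k < n.choose (k + 1) := by
      by_contra h
      have h4 : n.choose (k + 1) * (k + 1) ≤ n.choose k * (k + 1) :=
        Nat.mul_le_mul_right _ (not_lt.mp h)
      have h5 : n.choose k * (k + 1) < n.choose k * (n - k) :=
        Nat.mul_lt_mul_of_pos_left (by omega) h2
      omega
    simp only [Nat.add_eq_zero_iff, one_ne_zero, and_false, if_false, Nat.add_sub_cancel]
    omega

/-- The rows and columns `k, k+1, …, n-k` of the `k`-th block. -/
abbrev BlockIdx (n k : ℕ) : Type := ↥(Finset.Icc k (n - k))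

theorem card_blockIdx {n k : ℕ} (hk : k ≤ n / 2) :
    Fintype.card (BlockIdx n k) = n - 2 * k + 1 := by
  simp only [BlockIdx, Fintype.card_coe, Nat.card_Icc]
  omega

/-- The index set `S` of all `(k, b, i)` with `0 ≤ k ≤ ⌊n/2⌋`, `b` one of `q_k` values,
and `k ≤ i ≤ n-k`. -/
abbrev ChainIdx (n : ℕ) : Type :=
  Σ k : Fin (n / 2 + 1), Fin (chainCount n k) × BlockIdx n k

/-- For every `k ≤ ⌊n/2⌋` an ordering of the chains of `O(n)` from rank `k` to rank `n-k`. -/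
abbrev ChainOrder (n : ℕ) : Type :=
  ∀ k : Fin (n / 2 + 1), Fin (chainCount n k) ≃ Fin (chainsFrom n k).length

/-- The vector of `O(n)` with index `(k, b, i)`: the one of rank `i` on the `b`-th chain
`(x_k,…,x_{n-k})` from rank `k` to rank `n-k`. -/
def basisVec {n : ℕ} (σ : ChainOrder n) (s : ChainIdx n) : Finset (Fin n) → ℤ :=
  ((chainsFrom n s.1).get (σ s.1 s.2.1)).getD (s.2.2.1 - s.1) 0

/-- The real matrix `N(n)`: its columns are the normalized vectors of `O(n)`. -/
noncomputable def matN {n : ℕ} (σ : ChainOrder n) : Matrix (Finset (Fin n)) (ChainIdx n) ℝ :=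
  Matrix.of fun X s =>
    (basisVec σ s X : ℝ) / Real.sqrt (∑ Y : Finset (Fin n), (basisVec σ s Y : ℝ) ^ 2)

/-- `N(n)` as a complex matrix. -/
noncomputable def matNC {n : ℕ} (σ : ChainOrder n) : Matrix (Finset (Fin n)) (ChainIdx n) ℂ :=
  (matN σ).map Complex.ofReal

/-! ## The Terwilliger algebra and its block diagonalization -/

/-- The Terwilliger algebra `A_n` of the binary Hamming scheme: the complex `B(n) × B(n)` matrices
with `M(π(X), π(Y)) = M(X, Y)` for all permutations `π`. -/
def terwilliger (n : ℕ) :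
    StarSubalgebra ℂ (Matrix (Finset (Fin n)) (Finset (Fin n)) ℂ) where
  carrier := {M | ∀ (π : Equiv.Perm (Fin n)) (X Y : Finset (Fin n)),
    M (X.map π.toEmbedding) (Y.map π.toEmbedding) = M X Y}
  mul_mem' := by
    intro A B hA hB π X Y
    rw [Matrix.mul_apply, Matrix.mul_apply, ← (Equiv.finsetCongr π).sum_comp]
    refine Finset.sum_congr rfl fun Z _ => ?_
    simp only [Equiv.finsetCongr_apply]
    rw [hA, hB]
  add_mem' := by
    intro A B hA hB π X Y
    rw [Matrix.add_apply, Matrix.add_apply, hA, hB]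
  algebraMap_mem' := by
    intro r π X Y
    simp [Matrix.algebraMap_matrix_apply]
  star_mem' := by
    intro A hA π X Y
    rw [Matrix.star_apply, Matrix.star_apply, hA]

/-- The matrix `M^t_{i,j}`. -/
def matM (n i j t : ℕ) : Matrix (Finset (Fin n)) (Finset (Fin n)) ℂ :=
  Matrix.of fun X Y => if X.card = i ∧ Y.card = j ∧ (X ∩ Y).card = t then 1 else 0

theorem matM_mem (n i j t : ℕ) : matM n i j t ∈ terwilliger n := by
  intro π X Y
  simp [matM, ← Finset.map_inter]

/-- The algebra `⊕_{k=0}^{⌊n/2⌋} Mat(p_k × p_k)`, `p_k = n - 2k + 1`. -/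
abbrev BlockAlg (n : ℕ) : Type :=
  ∀ k : Fin (n / 2 + 1), Matrix (BlockIdx n k) (BlockIdx n k) ℂ

open scoped Kronecker in
/-- The block diagonal matrix in which the `k`-th block is repeated `q_k` times. -/
def repeatBlocks {n : ℕ} (B : BlockAlg n) : Matrix (ChainIdx n) (ChainIdx n) ℂ :=
  Matrix.blockDiagonal' fun k => (1 : Matrix (Fin (chainCount n k)) (Fin (chainCount n k)) ℂ) ⊗ₖ B k

/-- Conjugation by `N(n)`. -/
noncomputable def conjN {n : ℕ} (σ : ChainOrder n)
    (M : Matrix (Finset (Fin n)) (Finset (Fin n)) ℂ) : Matrix (ChainIdx n) (ChainIdx n) ℂ :=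
  (matNC σ).conjTranspose * M * matNC σ

/-- Dropping repeated blocks: of the `q_k` diagonal blocks with first index `k`, keep one. -/
def dropBlocks {n : ℕ} (D : Matrix (ChainIdx n) (ChainIdx n) ℂ) : BlockAlg n := fun k =>
  Matrix.of fun i j =>
    D ⟨k, ⟨0, chainCount_pos (Nat.lt_succ_iff.mp k.2)⟩, i⟩
      ⟨k, ⟨0, chainCount_pos (Nat.lt_succ_iff.mp k.2)⟩, j⟩

/-- The map `Φ`: conjugation by `N(n)` followed by dropping repeated blocks. -/
noncomputable def Phi {n : ℕ} (σ : ChainOrder n)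
    (M : Matrix (Finset (Fin n)) (Finset (Fin n)) ℂ) : BlockAlg n :=
  dropBlocks (conjN σ M)

/-- The binomial coefficient of two integers, which is `0` if the lower one is negative. -/
def binom (a b : ℤ) : ℤ := if 0 ≤ b then Ring.choose a b.toNat else 0

/-- The number `β^t_{i,j,k}`; the terms with `u < t` vanish, so `(-1)^{u+t} = (-1)^{u-t}`. -/
def beta (n i j k t : ℕ) : ℤ :=
  ∑ u ∈ Finset.range (n + 1), (-1) ^ (u + t) * binom u t * binom (n - 2 * k) (u - k) *
    binom (n - k - u) (i - u) * binom (n - k - u) (j - u)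

/-! Each chain of `O(n)` is a string of the representation of `sl₂` by the up and down operators on
`V(B(n))`: passing from `n` to `n + 1` tensors the representation with the two-dimensional one, and
one step of the algorithm splits a string into the two strings of this tensor product. As the up and
down operators are adjoint, the lengths within a string are known up to a common factor and the two
strings are orthogonal, so that by induction distinct strings are and `N(n)` is unitary. The
inclusion matrix `M^u_{u,j}` acts on vectors of rank `j` as a multiple of a power of the down
operator, hence maps the vectors of a string to explicit multiples of one another.
By binomial inversion in `u`, the products of the transpose of `M^u_{u,i}` with `M^u_{u,j}` span the
Terwilliger algebra. Their coefficients in the `k`-th block vanish for `u < k` but not for `u = k`,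
and this triangularity shows that their images span the block algebra. -/

open Finset Matrix

section General

theorem sum_alternating_choose_mul_choose {m N : ℕ} (hm : m ≤ N) (t : ℕ) :
    ∑ u ∈ range (N + 1), (-1 : ℤ) ^ (u + t) * u.choose t * m.choose u = if m = t then 1 else 0 := by
  rcases lt_or_ge m t with h | h
  · rw [if_neg h.ne]
    refine sum_eq_zero fun u _ => ?_
    rcases lt_or_ge u t with hu | hu
    · simp [Nat.choose_eq_zero_of_lt hu]
    · simp [Nat.choose_eq_zero_of_lt (h.trans_le hu)]
  obtain ⟨d, rfl⟩ := Nat.exists_eq_add_of_le h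
  have hterm (e : ℕ) : (-1 : ℤ) ^ (t + e + t) * (t + e).choose t * (t + d).choose (t + e) =
      (t + d).choose t * ((-1) ^ e * d.choose e) := by
    have htri := Nat.choose_mul (n := t + d) (k := t + e) (s := t) (by omega)
    rw [Nat.add_sub_cancel_left, Nat.add_sub_cancel_left] at htri
    have hsign : (-1 : ℤ) ^ (t + e + t) = (-1) ^ e := by
      rw [show t + e + t = e + 2 * t by ring, pow_add, pow_mul, neg_one_sq, one_pow, mul_one]
    zify at htri
    rw [hsign]
    linear_combination (-1 : ℤ) ^ e * htri
  rw [show N + 1 = t + (d + 1) + (N - (t + d)) by omega, sum_range_add, sum_range_add,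
    sum_eq_zero (s := range t), sum_eq_zero (s := range (N - (t + d)))]
  · simp only [hterm, ← mul_sum, Int.alternating_sum_range_choose, zero_add, add_zero]
    rcases eq_or_ne d 0 with rfl | hd
    · simp
    · simp [hd]
  · intro u _
    simp [Nat.choose_eq_zero_of_lt (show t + d < t + (d + 1) + u by omega)]
  · intro u hu
    simp [Nat.choose_eq_zero_of_lt (mem_range.1 hu)]

theorem mem_of_triangular_sum_mem {K V ι : Type*} [Field K] [AddCommGroup V] [Module K V]
    [LinearOrder ι] [Fintype ι] (P : Submodule K V) {c : ι → ι → K} {v : ι → V}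
    (hc : ∀ i j, i < j → c i j = 0) (hv : ∀ i, c i i = 0 → v i = 0)
    (hP : ∀ i, ∑ j, c i j • v j ∈ P) (i : ι) : v i ∈ P := by
  induction i using WellFoundedLT.induction with
  | ind i ih =>
    by_cases hi : c i i = 0
    · rw [hv i hi]
      exact P.zero_mem
    have hrest : ∑ j ∈ univ.erase i, c i j • v j ∈ P := by
      refine P.sum_mem fun j hj => ?_
      rcases lt_or_gt_of_ne (ne_of_mem_erase hj) with h | h
      · exact P.smul_mem _ (ih j h)
      · rw [hc i j h, zero_smul]
        exact P.zero_mem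
    have hsum := hP i
    rw [← add_sum_erase _ _ (mem_univ i)] at hsum
    exact (P.smul_mem_iff hi).1 ((P.add_mem_iff_left hrest).1 hsum)

theorem exists_perm_of_card_fiber_eq {α γ : Type*} [Fintype α] [DecidableEq γ] {f g : α → γ}
    (h : ∀ c, #{a | f a = c} = #{a | g a = c}) : ∃ π : Equiv.Perm α, ∀ a, g (π a) = f a := by
  have e (c : γ) : {a // f a = c} ≃ {a // g a = c} :=
    Fintype.equivOfCardEq (by rw [Fintype.card_subtype, Fintype.card_subtype, h])
  exact ⟨Equiv.ofFiberEquiv e, Equiv.ofFiberEquiv_map e⟩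

theorem exists_perm_map_eq_map_eq {α : Type*} [Finite α] [DecidableEq α] {X Y X' Y' : Finset α}
    (hX : #X = #X') (hY : #Y = #Y') (hXY : #(X ∩ Y) = #(X' ∩ Y')) :
    ∃ π : Equiv.Perm α, X.map π.toEmbedding = X' ∧ Y.map π.toEmbedding = Y' := by
  cases nonempty_fintype α
  have hfiber : ∀ c : Bool × Bool, #{a | (decide (a ∈ X), decide (a ∈ Y)) = c} =
      #{a | (decide (a ∈ X'), decide (a ∈ Y')) = c} := by
    have h1 := card_inter_add_card_sdiff X Y
    have h1' := card_inter_add_card_sdiff X' Y'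
    have h2 := card_inter_add_card_sdiff Y X
    have h2' := card_inter_add_card_sdiff Y' X'
    have h3 := card_union_add_card_inter X Y
    have h3' := card_union_add_card_inter X' Y'
    have h4 := card_compl_add_card (X ∪ Y)
    have h4' := card_compl_add_card (X' ∪ Y')
    have e1 (A B : Finset α) : ({a | a ∈ A ∧ a ∈ B} : Finset α) = A ∩ B := by ext; simp
    have e2 (A B : Finset α) : ({a | a ∈ A ∧ a ∉ B} : Finset α) = A \ B := by ext; simp
    have e3 (A B : Finset α) : ({a | a ∉ A ∧ a ∈ B} : Finset α) = B \ A := by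
      ext; simp [and_comm]
    have e4 (A B : Finset α) : ({a | a ∉ A ∧ a ∉ B} : Finset α) = (A ∪ B)ᶜ := by ext; simp
    rw [inter_comm] at h2 h2'
    rintro ⟨_ | _, _ | _⟩ <;>
      simp only [Prod.mk.injEq, decide_eq_true_eq, decide_eq_false_iff_not, e1, e2, e3, e4] <;>
      omega
  obtain ⟨π, hπ⟩ := exists_perm_of_card_fiber_eq hfiber
  simp only [Prod.mk.injEq, decide_eq_decide] at hπ
  refine ⟨π, ?_, ?_⟩ <;> ext a <;> obtain ⟨b, rfl⟩ := π.surjective a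
  · simp [(hπ b).1]
  · simp [(hπ b).2]

theorem exists_starAlgEquiv_of_range_eq {R A B C : Type*} [CommSemiring R] [StarRing R]
    [Semiring A] [StarRing A] [Algebra R A] [StarModule R A]
    [Semiring B] [StarRing B] [Algebra R B] [StarModule R B]
    [Semiring C] [StarRing C] [Algebra R C] [StarModule R C]
    {f : A →⋆ₐ[R] C} {g : B →⋆ₐ[R] C} (hf : Function.Injective f) (hg : Function.Injective g)
    (h : Set.range f = Set.range g) : ∃ e : A ≃⋆ₐ[R] B, ∀ a, g (e a) = f a := by
  let f' := f.codRestrict g.range fun a => (h ▸ Set.mem_range_self a : f a ∈ Set.range g)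
  have hf' : Function.Bijective f' := by
    refine ⟨fun a b hab => hf (congrArg Subtype.val hab), fun ⟨c, hc⟩ => ?_⟩
    obtain ⟨a, rfl⟩ : c ∈ Set.range f := h ▸ hc
    exact ⟨a, rfl⟩
  refine ⟨(StarAlgEquiv.ofBijective f' hf').trans (StarAlgEquiv.ofInjective g hg).symm,
    fun a => ?_⟩
  exact congrArg Subtype.val ((StarAlgEquiv.ofInjective g hg).apply_symm_apply (f' a))

/-- Conjugation by a rectangular matrix with orthonormal rows and columns. -/
def unitaryConj {R m n : Type*} [CommSemiring R] [StarRing R] [Fintype m] [Fintype n]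
    [DecidableEq m] [DecidableEq n] (N : Matrix m n R) (h₁ : Nᴴ * N = 1) (h₂ : N * Nᴴ = 1) :
    Matrix m m R →⋆ₐ[R] Matrix n n R where
  toFun M := Nᴴ * M * N
  map_one' := by rw [Matrix.mul_one, h₁]
  map_mul' A B := by
    calc Nᴴ * (A * B) * N = Nᴴ * (A * 1 * B) * N := by rw [Matrix.mul_one]
      _ = Nᴴ * A * N * (Nᴴ * B * N) := by simp only [← h₂, Matrix.mul_assoc]
  map_zero' := by simp
  map_add' A B := by rw [Matrix.mul_add, Matrix.add_mul]
  commutes' r := by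
    simp [Algebra.algebraMap_eq_smul_one, h₁]
  map_star' A := by
    simp [star_eq_conjTranspose, conjTranspose_mul, Matrix.mul_assoc]

theorem unitaryConj_injective {R m n : Type*} [CommSemiring R] [StarRing R] [Fintype m] [Fintype n]
    [DecidableEq m] [DecidableEq n] {N : Matrix m n R} (h₁ : Nᴴ * N = 1) (h₂ : N * Nᴴ = 1) :
    Function.Injective (unitaryConj N h₁ h₂) := by
  refine Function.LeftInverse.injective (g := fun D => N * D * Nᴴ) fun M => ?_
  calc N * (Nᴴ * M * N) * Nᴴ = N * Nᴴ * M * (N * Nᴴ) := by simp only [Matrix.mul_assoc]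
    _ = M := by rw [h₂, Matrix.one_mul, Matrix.mul_one]

end General

section SubsetOperators

variable {α R : Type*} [CommRing R]

/-- The function `v` on finite sets, regarded as a formal linear combination, is homogeneous of
rank `r`; the zero function is homogeneous of every rank. -/
def IsOfRank (v : Finset α → R) (r : ℕ) : Prop :=
  ∀ X, v X ≠ 0 → #X = r

theorem IsOfRank.smul {v : Finset α → R} {r : ℕ} (hv : IsOfRank v r) (c : R) :
    IsOfRank (c • v) r :=
  fun X hX => hv X (right_ne_zero_of_mul hX)

theorem IsOfRank.neg {v : Finset α → R} {r : ℕ} (hv : IsOfRank v r) : IsOfRank (-v) r :=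
  fun X hX => hv X (neg_ne_zero.1 hX)

variable [Fintype α]

theorem IsOfRank.dotProduct_eq_zero {v w : Finset α → R} {r s : ℕ} (hv : IsOfRank v r)
    (hw : IsOfRank w s) (hrs : r ≠ s) : v ⬝ᵥ w = 0 := by
  refine sum_eq_zero fun X _ => ?_
  by_contra hX
  exact hrs ((hv X (left_ne_zero_of_mul hX)).symm.trans (hw X (right_ne_zero_of_mul hX)))

variable [DecidableEq α]

/-- The up operator on formal linear combinations of finite sets, `X ↦ ∑ x ∉ X, X ∪ {x}`. -/
def upOp (α R : Type*) [CommRing R] [Fintype α] [DecidableEq α] :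
    (Finset α → R) →ₗ[R] Finset α → R where
  toFun v Z := ∑ x, if x ∈ Z then v (Z.erase x) else 0
  map_add' v w := by
    ext Z
    simp only [Pi.add_apply, ← sum_add_distrib, ite_add_ite, add_zero]
  map_smul' c v := by
    ext Z
    simp only [Pi.smul_apply, smul_eq_mul, mul_sum, mul_ite, mul_zero, RingHom.id_apply]

/-- The down operator on formal linear combinations of finite sets, `X ↦ ∑ x ∈ X, X \ {x}`. -/
def downOp (α R : Type*) [CommRing R] [Fintype α] [DecidableEq α] :
    (Finset α → R) →ₗ[R] Finset α → R where
  toFun v Z := ∑ x, if x ∉ Z then v (insert x Z) else 0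
  map_add' v w := by
    ext Z
    simp only [Pi.add_apply, ← sum_add_distrib, ite_add_ite, add_zero]
  map_smul' c v := by
    ext Z
    simp only [Pi.smul_apply, smul_eq_mul, mul_sum, mul_ite, mul_zero, RingHom.id_apply]

theorem upOp_apply (v : Finset α → R) (Z : Finset α) :
    upOp α R v Z = ∑ x, if x ∈ Z then v (Z.erase x) else 0 :=
  rfl

theorem downOp_apply (v : Finset α → R) (Z : Finset α) :
    downOp α R v Z = ∑ x, if x ∉ Z then v (insert x Z) else 0 :=
  rfl

theorem upOp_dotProduct (v w : Finset α → R) : upOp α R v ⬝ᵥ w = v ⬝ᵥ downOp α R w := by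
  simp only [dotProduct, upOp_apply, downOp_apply, sum_mul, mul_sum]
  rw [sum_comm, sum_comm (s := univ (α := Finset α))]
  refine sum_congr rfl fun x _ => ?_
  simp only [ite_mul, zero_mul, mul_ite, mul_zero, ← sum_filter]
  exact sum_bij' (fun Z _ => Z.erase x) (fun Z _ => insert x Z)
    (by simp) (by simp) (by simp +contextual) (by simp +contextual) (by simp +contextual)

/-- The functional form of the inclusion matrix: `X ↦ ∑ Z`, over the `u`-subsets `Z` of `X`. -/
def inclusionOp (u : ℕ) (v : Finset α → R) : Finset α → R := fun Z =>
  if #Z = u then ∑ Y, if Z ⊆ Y then v Y else 0 else 0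

theorem IsOfRank.inclusionOp_self {v : Finset α → R} {r : ℕ} (hv : IsOfRank v r) :
    inclusionOp r v = v := by
  ext Z
  rw [inclusionOp]
  split_ifs with hZ
  · rw [sum_eq_single_of_mem Z (mem_univ Z), if_pos Subset.rfl]
    intro Y _ hYZ
    by_contra h
    rw [ite_eq_right_iff, not_forall] at h
    obtain ⟨hsub, hY⟩ := h
    exact hYZ (eq_of_subset_of_card_le hsub (by rw [hv Y hY, hZ])).symm
  · by_contra h
    exact hZ (hv Z (Ne.symm h))

theorem IsOfRank.downOp_inclusionOp {v : Finset α → R} {r : ℕ} (hv : IsOfRank v r) (u : ℕ) :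
    downOp α R (inclusionOp (u + 1) v) = ((r : R) - u) • inclusionOp u v := by
  ext Z
  rw [downOp_apply, Pi.smul_apply, smul_eq_mul, inclusionOp]
  by_cases hZ : #Z = u
  swap
  · rw [if_neg hZ, mul_zero]
    refine sum_eq_zero fun x _ => ite_eq_right_iff.2 fun hx => if_neg ?_
    rwa [card_insert_of_notMem hx, Nat.add_right_cancel_iff]
  have hinner (Y : Finset α) :
      (∑ x, if x ∉ Z ∧ insert x Z ⊆ Y then v Y else 0) =
        ((r : R) - u) * if Z ⊆ Y then v Y else 0 := by
    by_cases hZY : Z ⊆ Y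
    swap
    · simp [insert_subset_iff, hZY]
    by_cases hY : v Y = 0
    · simp [hY]
    have hfilter : ({x | x ∉ Z ∧ insert x Z ⊆ Y} : Finset α) = Y \ Z := by
      ext x
      simp [insert_subset_iff, hZY, and_comm]
    rw [← sum_filter, hfilter, sum_const, nsmul_eq_mul, if_pos hZY, card_sdiff_of_subset hZY,
      Nat.cast_sub (card_le_card hZY), hv Y hY, hZ]
  rw [if_pos hZ, mul_sum]
  simp only [← hinner]
  rw [sum_comm]
  refine sum_congr rfl fun x _ => ?_
  by_cases hx : x ∈ Z
  · simp [hx]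
  · simp [hx, inclusionOp, card_insert_of_notMem, hZ]

end SubsetOperators

section JordanStrings

variable {α R : Type*} [CommRing R] [Fintype α] [DecidableEq α]

/-- A string of the representation of `sl₂` on `Finset α → R` by the up and down operators: `x 0`
is a lowest weight vector of rank `k`, and `x a = Uᵃ (x 0)` vanishes for `a > l`. The parameter `l`
enters through the eigenvalues of the down operator followed by the up operator. -/
structure IsJordanString (k l : ℕ) (x : ℕ → Finset α → R) : Prop where
  ne_zero : x 0 ≠ 0
  isOfRank : ∀ a, IsOfRank (x a) (k + a)
  upOp_apply : ∀ a, upOp α R (x a) = x (a + 1)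
  downOp_zero : downOp α R (x 0) = 0
  downOp_succ : ∀ a, downOp α R (x (a + 1)) = (((a : R) + 1) * (l - a)) • x a

namespace IsJordanString

variable {k l : ℕ} {x : ℕ → Finset α → R}

theorem dotProduct_self_succ (h : IsJordanString k l x) (a : ℕ) :
    x (a + 1) ⬝ᵥ x (a + 1) = ((a : R) + 1) * (l - a) * (x a ⬝ᵥ x a) := by
  nth_rw 1 [← h.upOp_apply]
  rw [upOp_dotProduct, h.downOp_succ, dotProduct_smul, smul_eq_mul]

theorem dotProduct_self (h : IsJordanString k l x) (a : ℕ) :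
    x a ⬝ᵥ x a = (a.factorial : R) ^ 2 * l.choose a * (x 0 ⬝ᵥ x 0) := by
  induction a with
  | zero => simp
  | succ a ih =>
    have hchoose : (l.choose (a + 1) : R) * (a + 1) = l.choose a * (l - a) := by
      rcases le_or_gt a l with hal | hal
      · have hnat := congrArg (Nat.cast (R := R)) (Nat.choose_succ_right_eq l a)
        push_cast [Nat.cast_sub hal] at hnat
        exact hnat
      · simp [Nat.choose_eq_zero_of_lt hal, Nat.choose_eq_zero_of_lt (hal.trans a.lt_succ_self)]
    rw [h.dotProduct_self_succ, ih, Nat.factorial_succ]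
    push_cast
    linear_combination -((a : R) + 1) * a.factorial ^ 2 * (x 0 ⬝ᵥ x 0) * hchoose

theorem apply_ne_zero [LinearOrder R] [IsStrictOrderedRing R] (h : IsJordanString k l x) {a : ℕ}
    (ha : a ≤ l) : x a ≠ 0 := by
  have hchoose : (l.choose a : R) ≠ 0 := Nat.cast_ne_zero.2 (Nat.choose_pos ha).ne'
  rw [← dotProduct_self_eq_zero.ne, h.dotProduct_self]
  exact mul_ne_zero (mul_ne_zero (by positivity) hchoose) (dotProduct_self_eq_zero.ne.2 h.ne_zero)

section NoZeroDivisors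

variable [NoZeroDivisors R] [CharZero R]

theorem inclusionOp_add (h : IsJordanString k l x) {b t : ℕ} (hbt : b + t ≤ l) :
    inclusionOp (k + b) (x (b + t)) =
      (((b + t).descFactorial t * (l - b).choose t : ℕ) : R) • x b := by
  induction t generalizing b with
  | zero => simpa using (h.isOfRank b).inclusionOp_self
  | succ t ih =>
    have hcoef : ((b + 1 + t).descFactorial t * (l - (b + 1)).choose t) * ((b + 1) * (l - b)) =
        (t + 1) * ((b + (t + 1)).descFactorial (t + 1) * (l - b).choose (t + 1)) := by
      obtain ⟨m, hm⟩ : ∃ m, l - b = m + 1 := ⟨l - b - 1, by omega⟩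
      rw [show l - (b + 1) = m by omega, hm, Nat.descFactorial_succ,
        show b + (t + 1) - t = b + 1 by omega, show b + 1 + t = b + (t + 1) by omega]
      linear_combination (b + (t + 1)).descFactorial t * (b + 1) * Nat.add_one_mul_choose_eq m t
    have hcast : ((b : R) + 1) * (l - b) = ((b + 1) * (l - b) : ℕ) := by
      push_cast [Nat.cast_sub (show b ≤ l by omega)]
      rfl
    have hdown := (h.isOfRank (b + (t + 1))).downOp_inclusionOp (k + b)
    rw [show k + b + 1 = k + (b + 1) by omega, show b + (t + 1) = b + 1 + t by omega,
      ih (by omega), map_smul, h.downOp_succ, smul_smul, hcast, ← Nat.cast_mul, hcoef,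
      Nat.cast_mul, mul_smul, Nat.cast_succ,
      show ((k + (b + 1 + t) : ℕ) : R) - (k + b : ℕ) = t + 1 by push_cast; ring,
      show b + 1 + t = b + (t + 1) by omega] at hdown
    exact smul_right_injective _ (Nat.cast_add_one_ne_zero (R := R) t) hdown.symm

theorem inclusionOp_of_lt (h : IsJordanString k l x) {a u : ℕ} (ha : a ≤ l) (hu : u < k) :
    inclusionOp u (x a) = 0 := by
  have hstep {u : ℕ} (hu : u < k) (h0 : downOp α R (inclusionOp (u + 1) (x a)) = 0) :
      inclusionOp u (x a) = 0 := by
    have hcoef : ((k + a : ℕ) : R) - u ≠ 0 := sub_ne_zero.2 (Nat.cast_injective.ne (by omega))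
    rw [(h.isOfRank a).downOp_inclusionOp] at h0
    exact (smul_eq_zero.1 h0).resolve_left hcoef
  refine hstep hu (Nat.decreasingInduction' (P := fun u => downOp α R (inclusionOp u (x a)) = 0)
    (fun u huk _ h0 => by rw [hstep huk h0, map_zero]) hu ?_)
  have htop := h.inclusionOp_add (b := 0) (t := a) (by rwa [zero_add])
  rw [add_zero, zero_add] at htop
  rw [htop, map_smul, h.downOp_zero, smul_zero]

end NoZeroDivisors

end IsJordanString

end JordanStrings

section Glue

variable {R : Type*} {n : ℕ}

/-- The trace of a subset of `Fin (n + 1)` on the first `n` points. -/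
def belowLast (X : Finset (Fin (n + 1))) : Finset (Fin n) := {i | i.castSucc ∈ X}

@[simp]
theorem mem_belowLast {X : Finset (Fin (n + 1))} {i : Fin n} :
    i ∈ belowLast X ↔ i.castSucc ∈ X := by
  simp [belowLast]

theorem belowLast_insert_last (X : Finset (Fin (n + 1))) :
    belowLast (insert (Fin.last n) X) = belowLast X := by
  ext i
  simp [Fin.castSucc_ne_last]

theorem belowLast_insert_castSucc (X : Finset (Fin (n + 1))) (i : Fin n) :
    belowLast (insert i.castSucc X) = insert i (belowLast X) := by
  ext j
  simp

theorem belowLast_erase_last (X : Finset (Fin (n + 1))) :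
    belowLast (X.erase (Fin.last n)) = belowLast X := by
  ext i
  simp [Fin.castSucc_ne_last]

theorem belowLast_erase_castSucc (X : Finset (Fin (n + 1))) (i : Fin n) :
    belowLast (X.erase i.castSucc) = (belowLast X).erase i := by
  ext j
  simp

theorem card_eq_card_belowLast_add (X : Finset (Fin (n + 1))) :
    #X = #(belowLast X) + if Fin.last n ∈ X then 1 else 0 := by
  rw [← filter_univ_mem X, card_filter, Fin.sum_univ_castSucc, belowLast, card_filter]
  simp

/-- A subset of `Fin (n + 1)` as its trace on the first `n` points together with the membership of
the last one. -/
def splitLast (n : ℕ) : Finset (Fin (n + 1)) ≃ Finset (Fin n) × Bool where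
  toFun X := (belowLast X, decide (Fin.last n ∈ X))
  invFun p := bif p.2 then insert (Fin.last n) (p.1.map Fin.castSuccEmb)
    else p.1.map Fin.castSuccEmb
  left_inv X := by
    ext i
    by_cases h : Fin.last n ∈ X <;> cases i using Fin.lastCases <;>
      simp [h, Fin.castSucc_ne_last]
  right_inv p := by
    obtain ⟨Y, b⟩ := p
    cases b <;> simp [Finset.ext_iff, Fin.castSucc_ne_last]

/-- The function on subsets of `Fin (n + 1)` that is `v` on those without the last point and `w` on
those with it. -/
def glue (v w : Finset (Fin n) → R) : Finset (Fin (n + 1)) → R := fun X =>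
  if Fin.last n ∈ X then w (belowLast X) else v (belowLast X)

theorem glue_splitLast_symm (v w : Finset (Fin n) → R) (p : Finset (Fin n) × Bool) :
    glue v w ((splitLast n).symm p) = bif p.2 then w p.1 else v p.1 := by
  obtain ⟨X, rfl⟩ := (splitLast n).surjective p
  rw [Equiv.symm_apply_apply]
  by_cases h : Fin.last n ∈ X <;> simp [glue, splitLast, h]

theorem glue_eq_zero_iff [Zero R] {v w : Finset (Fin n) → R} : glue v w = 0 ↔ v = 0 ∧ w = 0 := by
  refine ⟨fun h => ⟨funext fun Y => ?_, funext fun Y => ?_⟩, ?_⟩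
  · simpa [h] using (glue_splitLast_symm v w (Y, false)).symm
  · simpa [h] using (glue_splitLast_symm v w (Y, true)).symm
  · rintro ⟨rfl, rfl⟩
    ext X
    simp [glue]

theorem smul_glue [CommRing R] (c : R) (v w : Finset (Fin n) → R) :
    c • glue v w = glue (c • v) (c • w) := by
  ext X
  simp only [glue, Pi.smul_apply, smul_ite]

theorem glue_dotProduct_glue [CommRing R] (v w v' w' : Finset (Fin n) → R) :
    glue v w ⬝ᵥ glue v' w' = v ⬝ᵥ v' + w ⬝ᵥ w' := by
  simp only [dotProduct, ← (splitLast n).symm.sum_comp, glue_splitLast_symm, Fintype.sum_prod_type,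
    ← sum_add_distrib]
  simp [add_comm]

variable [CommRing R]

theorem isOfRank_glue {v w : Finset (Fin n) → R} {r : ℕ} (hv : IsOfRank v r)
    (hw : ∀ X, w X ≠ 0 → #X + 1 = r) : IsOfRank (glue v w) r := by
  intro X hX
  rw [glue] at hX
  rw [card_eq_card_belowLast_add]
  split_ifs at hX ⊢ with h
  exacts [hw _ hX, hv _ hX]

theorem upOp_glue (v w : Finset (Fin n) → R) :
    upOp _ R (glue v w) = glue (upOp _ R v) (v + upOp _ R w) := by
  ext X
  rw [upOp_apply, Fin.sum_univ_castSucc]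
  by_cases h : Fin.last n ∈ X
  · simp [glue, upOp_apply, belowLast_erase_castSucc, belowLast_erase_last, h, add_comm,
      (Fin.castSucc_ne_last _).symm]
  · simp [glue, upOp_apply, belowLast_erase_castSucc, h]

theorem downOp_glue (v w : Finset (Fin n) → R) :
    downOp _ R (glue v w) = glue (downOp _ R v + w) (downOp _ R w) := by
  ext X
  rw [downOp_apply, Fin.sum_univ_castSucc]
  by_cases h : Fin.last n ∈ X
  · simp [glue, downOp_apply, belowLast_insert_castSucc, h]
  · simp [glue, downOp_apply, belowLast_insert_castSucc, belowLast_insert_last, h,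
      (Fin.castSucc_ne_last _).symm]

/-- The longer of the two strings on subsets of `Fin (n + 1)` into which the string `x` splits: the
tensor product with the two-dimensional representation of `sl₂` is decomposed by Clebsch–Gordan. -/
def mainString (x : ℕ → Finset (Fin n) → R) : ℕ → Finset (Fin (n + 1)) → R := fun a =>
  glue (x a) ((a : R) • x (a - 1))

/-- The shorter of the two strings on subsets of `Fin (n + 1)` into which the string `x` splits; `l`
is the parameter of `x`. -/
def sideString (l : ℕ) (x : ℕ → Finset (Fin n) → R) : ℕ → Finset (Fin (n + 1)) → R := fun a =>
  glue (-x (a + 1)) (((l : R) - a) • x a)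

variable {k l : ℕ} {x : ℕ → Finset (Fin n) → R}

theorem isJordanString_mainString (h : IsJordanString k l x) :
    IsJordanString k (l + 1) (mainString x) where
  ne_zero := by simp [mainString, glue_eq_zero_iff, h.ne_zero]
  isOfRank a := by
    refine isOfRank_glue (h.isOfRank a) fun X hX => ?_
    cases a with
    | zero => simp at hX
    | succ a => rw [(h.isOfRank a).smul _ X hX, add_assoc]
  upOp_apply a := by
    rw [mainString, upOp_glue, map_smul, h.upOp_apply, h.upOp_apply, mainString,
      add_tsub_cancel_right]
    cases a with
    | zero => simp
    | succ a =>
      rw [add_tsub_cancel_right]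
      congr 1
      push_cast
      module
  downOp_zero := by simp [mainString, downOp_glue, h.downOp_zero, glue_eq_zero_iff]
  downOp_succ a := by
    rw [mainString, downOp_glue, map_smul, add_tsub_cancel_right, h.downOp_succ, mainString,
      smul_glue]
    cases a with
    | zero => simp [h.downOp_zero, add_smul]
    | succ a =>
      rw [add_tsub_cancel_right, h.downOp_succ]
      congr 1 <;> push_cast <;> module

theorem isJordanString_sideString [NoZeroDivisors R] [CharZero R]
    (h : IsJordanString k (l + 1) x) :
    IsJordanString (k + 1) l (sideString (l + 1) x) where
  ne_zero := by
    have hl : ((l + 1 : ℕ) : R) ≠ 0 := Nat.cast_ne_zero.2 l.succ_ne_zero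
    rw [sideString, Ne, glue_eq_zero_iff, Nat.cast_zero, sub_zero]
    exact fun h0 => (smul_ne_zero hl h.ne_zero) h0.2
  isOfRank a := by
    refine isOfRank_glue ?_ fun X hX => ?_
    · rw [add_assoc, add_comm 1 a]
      exact (h.isOfRank (a + 1)).neg
    · rw [(h.isOfRank a).smul _ X hX]
      omega
  upOp_apply a := by
    rw [sideString, upOp_glue, map_neg, map_smul, h.upOp_apply, h.upOp_apply, sideString]
    congr 1
    push_cast
    module
  downOp_zero := by
    rw [sideString, downOp_glue, map_neg, map_smul, h.downOp_succ, h.downOp_zero, glue_eq_zero_iff]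
    push_cast
    constructor <;> module
  downOp_succ a := by
    rw [sideString, downOp_glue, map_neg, map_smul, h.downOp_succ, h.downOp_succ, sideString,
      smul_glue]
    congr 1 <;> push_cast <;> module

theorem mainString_dotProduct_sideString (h : IsJordanString k l x) (a b : ℕ) :
    mainString x a ⬝ᵥ sideString l x b = 0 := by
  rw [mainString, sideString, glue_dotProduct_glue, dotProduct_neg, smul_dotProduct,
    dotProduct_smul]
  rcases eq_or_ne a (b + 1) with rfl | hab
  · rw [h.dotProduct_self_succ, add_tsub_cancel_right]
    simp only [smul_eq_mul]
    push_cast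
    ring
  · rw [(h.isOfRank a).dotProduct_eq_zero (h.isOfRank (b + 1)) (by omega)]
    rcases a with _ | a
    · simp
    · rw [(h.isOfRank _).dotProduct_eq_zero (h.isOfRank b) (by omega)]
      simp

end Glue

section BooleanChains

/-- A chain, given as a list, as the sequence of its vectors continued by zero. -/
def chainSeq {V : Type*} [Zero V] (c : List V) : ℕ → V := fun a => c.getD a 0

theorem chainSeq_of_length_le {V : Type*} [Zero V] {c : List V} {a : ℕ} (h : c.length ≤ a) :
    chainSeq c a = 0 :=
  List.getD_eq_default _ _ h

theorem chainSeq_map {V W : Type*} [Zero V] [Zero W] {f : V → W} (hf : f 0 = 0) (c : List V)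
    (a : ℕ) : chainSeq (c.map f) a = f (chainSeq c a) := by
  rw [chainSeq, ← hf, List.getD_map, chainSeq]

theorem chainSeq_map_range {V : Type*} [Zero V] {m : ℕ} {x : ℕ → V} (h : ∀ a, m ≤ a → x a = 0) :
    chainSeq ((List.range m).map x) = x := by
  ext1 a
  rcases lt_or_ge a m with ha | ha
  · simp [chainSeq, ha]
  · rw [chainSeq_of_length_le (by simpa using ha), h a ha]

theorem exists_chainSeq_eq_of_mem {V : Type*} [Zero V] {c : List V} {v : V} (h : v ∈ c) :
    ∃ a < c.length, chainSeq c a = v := by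
  obtain ⟨a, ha, rfl⟩ := List.getElem_of_mem h
  exact ⟨a, ha, List.getD_eq_getElem _ _ ha⟩

theorem sum_ite_smul_chainSeq {V : Type*} [AddCommGroup V] (c : List V) (s : ℤ) (a : ℕ) :
    ∑ i ∈ range c.length, (if i = a then s else 0) • chainSeq c i = s • chainSeq c a := by
  simp only [ite_smul, zero_smul, sum_ite_eq', mem_range]
  split_ifs with h
  · rfl
  · rw [chainSeq_of_length_le (not_lt.1 h), smul_zero]

variable {n : ℕ}

/-- The longer chain of `B(n + 1)` produced from the chain `c` of `B(n)`. -/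
def mainChain (c : List (Finset (Fin n) → ℤ)) : List (Finset (Fin (n + 1)) → ℤ) :=
  (List.range (c.length + 1)).map (mainString (chainSeq c))

/-- The shorter chain of `B(n + 1)` produced from the chain `c` of `B(n)`, which is empty if `c` has
only one vector. -/
def sideChain (c : List (Finset (Fin n) → ℤ)) : List (Finset (Fin (n + 1)) → ℤ) :=
  (List.range (c.length - 1)).map (sideString (c.length - 1) (chainSeq c))

/-- The chains of `B(n + 1)` produced from the chain `c` of `B(n)`. -/
def childChains (c : List (Finset (Fin n) → ℤ)) : List (List (Finset (Fin (n + 1)) → ℤ)) :=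
  mainChain c :: if 1 < c.length then [sideChain c] else []

theorem chainSeq_mainChain (c : List (Finset (Fin n) → ℤ)) :
    chainSeq (mainChain c) = mainString (chainSeq c) := by
  refine chainSeq_map_range fun a ha => ?_
  rw [mainString, chainSeq_of_length_le (by omega), chainSeq_of_length_le (by omega), smul_zero,
    glue_eq_zero_iff]
  exact ⟨rfl, rfl⟩

theorem chainSeq_sideChain (c : List (Finset (Fin n) → ℤ)) :
    chainSeq (sideChain c) = sideString (c.length - 1) (chainSeq c) := by
  refine chainSeq_map_range fun a ha => ?_
  rw [sideString, chainSeq_of_length_le (by omega), glue_eq_zero_iff, neg_zero]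
  refine ⟨rfl, ?_⟩
  rcases ha.eq_or_lt with rfl | ha
  · rw [sub_self, zero_smul]
  · rw [chainSeq_of_length_le (by omega), smul_zero]

theorem pairTransfer_pairUnit {p r : ℕ} (hr : r ≤ p) :
    pairTransfer p 0 (pairUnit r 0) = pairVec (p + 1) 1 r 1 := by
  rw [pairTransfer, sum_eq_single_of_mem r (mem_range_succ_iff.2 hr)]
  · simp [pairUnit]
  · intro i _ hi
    simp [pairUnit, hi]

theorem pairBTK_one (p : ℕ) :
    pairBTK p 1 = (List.range (p + 2)).map (pairMain p 1) ::
      if 0 < p then [(List.range p).map fun r => pairVec p 1 r 1] else [] := by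
  cases p with
  | zero =>
    have h : ∀ r ≤ 1, pairMain 0 1 r = pairUnit 0 r := by
      intro r hr
      ext i j
      interval_cases r <;> rcases i with _ | i <;> rcases j with _ | _ | j <;>
        simp [pairMain, pairUnit]
    simp [pairBTK, List.range_succ, h]
  | succ p =>
    have hright : pairBTK p 0 = [(List.range (p + 1)).map fun i => pairUnit i 0] := by
      cases p <;> simp [pairBTK]
    rw [pairBTK, hright, if_pos p.succ_pos]
    simp only [List.map_cons, List.map_nil, List.map_map]
    congr 2
    refine List.map_congr_left fun r hr => pairTransfer_pairUnit ?_
    exact Nat.lt_succ_iff.1 (List.mem_range.1 hr)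

/-- The restriction of a vector of `V(M(n,k₁,…,kₙ))` to `B(n)`. -/
def restrictBool (v : (Fin n → ℕ) → ℤ) : Finset (Fin n) → ℤ :=
  fun X => v fun i => if i ∈ X then 1 else 0

theorem restrictBool_chainMap (x : List ((Fin n → ℕ) → ℤ)) (w : ℕ → ℕ → ℤ) :
    restrictBool (chainMap 1 x w) =
      glue (∑ i ∈ range x.length, w i 0 • chainSeq (x.map restrictBool) i)
        (∑ i ∈ range x.length, w i 1 • chainSeq (x.map restrictBool) i) := by
  ext X
  simp only [chainSeq_map (f := restrictBool) rfl]
  by_cases h : Fin.last n ∈ X <;>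
    simp [restrictBool, chainMap, glue, h, sum_range_succ, layerCopy, Finset.sum_apply, chainSeq]

theorem restrictBool_chainMap_pairMain (x : List ((Fin n → ℕ) → ℤ)) (r : ℕ) :
    restrictBool (chainMap 1 x (pairMain (x.length - 1) 1 r)) =
      mainString (chainSeq (x.map restrictBool)) r := by
  have h0 : ∀ i ∈ range x.length,
      pairMain (x.length - 1) 1 r i 0 = if i = r then 1 else 0 := by
    intro i hi
    rcases eq_or_ne i r with rfl | hir
    · simp [pairMain, Nat.le_sub_one_of_lt (mem_range.1 hi)]
    · simp [pairMain, hir]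
  have h1 : ∀ i ∈ range x.length,
      pairMain (x.length - 1) 1 r i 1 = if i = r - 1 then (r : ℤ) else 0 := by
    intro i hi
    cases r with
    | zero => simp [pairMain]
    | succ r =>
      rcases eq_or_ne i r with rfl | hir
      · simp [pairMain, Nat.le_sub_one_of_lt (mem_range.1 hi)]
      · simp [pairMain, hir]
  have hsum := sum_ite_smul_chainSeq (x.map restrictBool)
  simp only [List.length_map] at hsum
  rw [restrictBool_chainMap, sum_congr rfl fun i hi => by rw [h0 i hi], hsum,
    sum_congr rfl fun i hi => by rw [h1 i hi], hsum, one_smul, mainString]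

theorem restrictBool_chainMap_pairVec (x : List ((Fin n → ℕ) → ℤ)) (r : ℕ) :
    restrictBool (chainMap 1 x (pairVec (x.length - 1) 1 r 1)) =
      sideString (x.length - 1) (chainSeq (x.map restrictBool)) r := by
  have h0 (i : ℕ) : pairVec (x.length - 1) 1 r 1 i 0 = if i = r + 1 then -1 else 0 := by
    simp [pairVec, pairUnit, apply_ite]
  have h1 (i : ℕ) : pairVec (x.length - 1) 1 r 1 i 1 =
      if i = r then ((x.length - 1 : ℕ) : ℤ) - r else 0 := by
    simp [pairVec, pairUnit]
  have hsum := sum_ite_smul_chainSeq (x.map restrictBool)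
  simp only [List.length_map] at hsum
  simp only [restrictBool_chainMap, h0, h1, hsum, neg_smul, one_smul, sideString]

theorem map_restrictBool_pairBTK {x : List ((Fin n → ℕ) → ℤ)} (hx : x ≠ []) :
    ((pairBTK (x.length - 1) 1).map (List.map (chainMap 1 x))).map (List.map restrictBool) =
      childChains (x.map restrictBool) := by
  have hlen := List.length_pos_of_ne_nil hx
  rw [pairBTK_one, childChains, mainChain, sideChain, List.length_map,
    show x.length - 1 + 2 = x.length + 1 by omega]
  simp only [Nat.sub_pos_iff_lt, apply_ite (List.map (List.map (chainMap 1 x))),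
    apply_ite (List.map (List.map restrictBool)), List.map_cons, List.map_nil, List.map_map]
  simp only [Function.comp_def, restrictBool_chainMap_pairMain, restrictBool_chainMap_pairVec]

theorem ne_nil_of_mem_linearBTK {x : List ((Fin n → ℕ) → ℤ)}
    (hx : x ∈ linearBTK n fun _ => 1) : x ≠ [] := by
  cases n with
  | zero => simp_all [linearBTK]
  | succ n =>
    simp only [linearBTK, pairBTK_one, List.mem_flatMap, List.map_cons, List.mem_cons] at hx
    obtain ⟨y, -, rfl | hx⟩ := hx
    · simp
    · split_ifs at hx with h
      · simp only [List.map_cons, List.map_nil, List.mem_singleton] at hx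
        simpa [hx] using h.ne'
      · simp at hx

theorem boolChains_succ (n : ℕ) : boolChains (n + 1) = (boolChains n).flatMap childChains := by
  change ((linearBTK n fun _ => 1).flatMap _).map (List.map restrictBool) =
    ((linearBTK n fun _ => 1).map (List.map restrictBool)).flatMap childChains
  rw [List.map_flatMap, List.flatMap_map]
  exact List.flatMap_congr fun x hx => map_restrictBool_pairBTK (ne_nil_of_mem_linearBTK hx)

end BooleanChains

section SymmetricChains

variable {n k : ℕ} {c : List (Finset (Fin n) → ℤ)}

/-- `c` is a Jordan chain of `B(n)` whose ranks run from `k` to `n - k`; the equation between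
natural numbers says that the last rank is `k + (c.length - 1) = n - k`. -/
structure IsSymmetricChain (k : ℕ) (c : List (Finset (Fin n) → ℤ)) : Prop where
  length_add : c.length + 2 * k = n + 1
  isJordanString : IsJordanString k (c.length - 1) (chainSeq c)

namespace IsSymmetricChain

theorem length_pos (h : IsSymmetricChain k c) : 0 < c.length := by
  by_contra hc
  exact h.isJordanString.ne_zero (chainSeq_of_length_le (not_lt.1 hc))

theorem hasRank (h : IsSymmetricChain k c) {a : ℕ} (ha : a < c.length) :
    HasRank (chainSeq c a) (k + a) :=
  ⟨h.isJordanString.apply_ne_zero (Nat.le_sub_one_of_lt ha), h.isJordanString.isOfRank a⟩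

protected theorem mainChain (h : IsSymmetricChain k c) : IsSymmetricChain k (mainChain c) := by
  have hlen : (mainChain c).length = c.length + 1 := by simp [mainChain]
  refine ⟨by rw [hlen, ← h.length_add]; ring, ?_⟩
  rw [chainSeq_mainChain, hlen, show c.length + 1 - 1 = c.length - 1 + 1 by
    have := h.length_pos; omega]
  exact isJordanString_mainString h.isJordanString

protected theorem sideChain (h : IsSymmetricChain k c) (hc : 1 < c.length) :
    IsSymmetricChain (k + 1) (sideChain c) := by
  have hlen : (sideChain c).length = c.length - 1 := by simp [sideChain]
  obtain ⟨l, hl⟩ : ∃ l, c.length - 1 = l + 1 := ⟨c.length - 2, by omega⟩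
  have hsum := h.length_add
  refine ⟨by omega, ?_⟩
  rw [chainSeq_sideChain, hlen, hl, Nat.add_sub_cancel]
  exact isJordanString_sideString (hl ▸ h.isJordanString)

end IsSymmetricChain

theorem HasRank.unique {v : Finset (Fin n) → ℤ} {r s : ℕ} (hr : HasRank v r) (hs : HasRank v s) :
    r = s := by
  obtain ⟨X, hX⟩ := Function.ne_iff.1 hr.1
  exact (hr.2 X hX).symm.trans (hs.2 X hX)

theorem mem_childChains {d : List (Finset (Fin (n + 1)) → ℤ)} :
    d ∈ childChains c ↔ d = mainChain c ∨ 1 < c.length ∧ d = sideChain c := by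
  rw [childChains, List.mem_cons]
  split_ifs with h <;> simp [h]

theorem exists_isSymmetricChain_of_mem_boolChains (hc : c ∈ boolChains n) :
    ∃ k, IsSymmetricChain k c := by
  induction n with
  | zero =>
    obtain rfl : c = [fun _ => 1] := by simpa [boolChains, linearBTK] using hc
    refine ⟨0, by simp, ?_, fun a X hX => ?_, fun a => ?_, ?_, fun a => ?_⟩
    · exact fun h => one_ne_zero (congrFun h ∅)
    · rcases a with _ | a
      · exact card_eq_zero.2 (Subsingleton.elim X ∅)
      · simp [chainSeq] at hX
    · ext X
      simp [upOp_apply, chainSeq]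
    · ext X
      simp [downOp_apply]
    · rcases a with _ | a <;> simp [chainSeq]
  | succ n ih =>
    rw [boolChains_succ, List.mem_flatMap] at hc
    obtain ⟨d, hd, hc⟩ := hc
    obtain ⟨k, hk⟩ := ih hd
    rcases mem_childChains.1 hc with rfl | ⟨hlen, rfl⟩
    exacts [⟨k, hk.mainChain⟩, ⟨k + 1, hk.sideChain hlen⟩]

theorem mem_chainsFrom : c ∈ chainsFrom n k ↔ c ∈ boolChains n ∧ IsSymmetricChain k c := by
  have hhead (c : List (Finset (Fin n) → ℤ)) : c.headD 0 = chainSeq c 0 := by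
    cases c <;> simp [chainSeq]
  have hlast (c : List (Finset (Fin n) → ℤ)) : c.getLastD 0 = chainSeq c (c.length - 1) := by
    rw [chainSeq, List.getLastD_eq_getLast?, List.getLast?_eq_getElem?,
      List.getD_eq_getElem?_getD]
  rw [chainsFrom, List.mem_filter, decide_eq_true_iff, hhead, hlast]
  refine and_congr_right fun hc => ⟨fun h => ?_, fun h => ⟨h.hasRank h.length_pos, ?_⟩⟩
  · obtain ⟨j, hj⟩ := exists_isSymmetricChain_of_mem_boolChains hc
    rwa [h.1.unique (hj.hasRank hj.length_pos)]
  · have hlen := h.length_add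
    have hpos := h.length_pos
    rw [show n - k = k + (c.length - 1) by omega]
    exact h.hasRank (by omega)

theorem chainsFrom_eq_filter_length (n k : ℕ) :
    chainsFrom n k = (boolChains n).filter fun c => c.length + 2 * k = n + 1 := by
  refine List.filter_congr fun c hc => ?_
  have hmem := mem_chainsFrom (k := k) (c := c)
  rw [chainsFrom, List.mem_filter, and_iff_right hc, and_iff_right hc] at hmem
  obtain ⟨j, hj⟩ := exists_isSymmetricChain_of_mem_boolChains hc
  rw [Bool.eq_iff_iff, hmem, decide_eq_true_iff]
  refine ⟨IsSymmetricChain.length_add, fun h => ?_⟩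
  have hlen := hj.length_add
  rwa [show k = j by omega]

theorem countP_length_flatMap_childChains (L : List (List (Finset (Fin n) → ℤ))) (m : ℕ) :
    ((L.flatMap childChains).countP fun c => c.length = m + 1) =
      (L.countP fun c => c.length = m + 2) + L.countP fun c => c.length = m := by
  have hchild (c : List (Finset (Fin n) → ℤ)) :
      ((childChains c).countP fun d => d.length = m + 1) =
        (if c.length = m + 2 then 1 else 0) + if c.length = m then 1 else 0 := by
    rcases lt_or_ge 1 c.length with hc | hc
    · simp [childChains, mainChain, sideChain, hc, List.countP_cons,
        show c.length - 1 = m + 1 ↔ c.length = m + 2 by omega]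
    · simp [childChains, mainChain, hc.not_gt, List.countP_cons, show c.length ≠ m + 2 by omega]
  induction L with
  | nil => simp
  | cons c L ih =>
    simp only [List.flatMap_cons, List.countP_append, List.countP_cons, ih, hchild,
      decide_eq_true_eq]
    ring

theorem countP_length_boolChains_add {m : ℕ} (h : m + 2 * k = n + 1) :
    ((boolChains n).countP fun c => c.length = m) + (if k = 0 then 0 else n.choose (k - 1)) =
      n.choose k := by
  induction n generalizing m k with
  | zero =>
    obtain ⟨rfl, rfl⟩ : m = 1 ∧ k = 0 := by omega
    simp [boolChains, linearBTK]
  | succ n ih =>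
    rcases m with _ | m
    · have hzero : ((boolChains (n + 1)).countP fun c => c.length = 0) = 0 := by
        refine List.countP_eq_zero.2 fun c hc => ?_
        obtain ⟨j, hj⟩ := exists_isSymmetricChain_of_mem_boolChains hc
        simpa using hj.length_pos.ne'
      rw [hzero, zero_add, if_neg (by omega)]
      exact Nat.choose_symm_of_eq_add (by omega)
    rw [boolChains_succ, countP_length_flatMap_childChains]
    have hm := ih (m := m) (k := k) (by omega)
    rcases k with _ | k
    · have hlong : ((boolChains n).countP fun c => c.length = m + 2) = 0 := by
        refine List.countP_eq_zero.2 fun c hc => ?_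
        obtain ⟨j, hj⟩ := exists_isSymmetricChain_of_mem_boolChains hc
        have hlen := hj.length_add
        simp only [decide_eq_true_eq]
        omega
      simpa [hlong] using hm
    · have hm' := ih (m := m + 2) (k := k) (by omega)
      rcases k with _ | k
      · simp only [zero_add, if_true, one_ne_zero, if_false, Nat.sub_self, Nat.choose_zero_right,
          Nat.choose_one_right] at hm hm' ⊢
        omega
      · simp only [Nat.add_eq_zero_iff, one_ne_zero, and_false, if_false, Nat.add_sub_cancel]
          at hm hm' ⊢
        rw [Nat.choose_succ_succ' n k, Nat.choose_succ_succ' n (k + 1)]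
        omega

theorem length_chainsFrom (hk : k ≤ n / 2) : (chainsFrom n k).length = chainCount n k := by
  have hcount := countP_length_boolChains_add (m := n + 1 - 2 * k) (k := k) (n := n) (by omega)
  have hfilter : chainsFrom n k = (boolChains n).filter fun c => c.length = n + 1 - 2 * k := by
    rw [chainsFrom_eq_filter_length]
    exact List.filter_congr fun c _ => decide_eq_decide.2 (by omega)
  rw [hfilter, ← List.countP_eq_length_filter]
  exact eq_tsub_of_add_eq hcount

theorem sum_length_boolChains (n : ℕ) : ((boolChains n).map List.length).sum = 2 ^ n := by
  induction n with
  | zero => simp [boolChains, linearBTK]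
  | succ n ih =>
    have hchild : ∀ c ∈ boolChains n, ((childChains c).map List.length).sum = c.length * 2 := by
      intro c hc
      obtain ⟨k, hk⟩ := exists_isSymmetricChain_of_mem_boolChains hc
      have hpos := hk.length_pos
      rw [childChains]
      split_ifs <;> simp [mainChain, sideChain] <;> omega
    rw [boolChains_succ, List.map_flatMap, List.flatMap_def, List.sum_flatten, List.map_map,
      List.map_congr_left (g := fun c => c.length * 2) hchild, List.sum_map_mul_right, ih, pow_succ]

theorem exists_chainSeq_eq_glue_of_mem_childChains {d : List (Finset (Fin (n + 1)) → ℤ)}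
    (hd : d ∈ childChains c) (a : ℕ) :
    ∃ (i j : ℕ) (s t : ℤ), chainSeq d a = glue (s • chainSeq c i) (t • chainSeq c j) := by
  rcases mem_childChains.1 hd with rfl | ⟨-, rfl⟩
  · exact ⟨a, a - 1, 1, a, by rw [chainSeq_mainChain, one_smul]; rfl⟩
  · exact ⟨a + 1, a, -1, _, by rw [chainSeq_sideChain, neg_one_smul]; rfl⟩

theorem pairwise_dotProduct_eq_zero_boolChains (n : ℕ) :
    (boolChains n).Pairwise fun c d => ∀ a b, chainSeq c a ⬝ᵥ chainSeq d b = 0 := by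
  induction n with
  | zero => simp [boolChains, linearBTK]
  | succ n ih =>
    rw [boolChains_succ, List.pairwise_flatMap]
    refine ⟨fun c hc => ?_, ih.imp fun {c d} hcd c' hc' d' hd' a b => ?_⟩
    · obtain ⟨k, hk⟩ := exists_isSymmetricChain_of_mem_boolChains hc
      rw [childChains]
      split_ifs
      · refine List.pairwise_pair.2 fun a b => ?_
        rw [chainSeq_mainChain, chainSeq_sideChain]
        exact mainString_dotProduct_sideString hk.isJordanString a b
      · exact List.pairwise_singleton _ _
    · obtain ⟨i, j, s, t, ha⟩ := exists_chainSeq_eq_glue_of_mem_childChains hc' a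
      obtain ⟨i', j', s', t', hb⟩ := exists_chainSeq_eq_glue_of_mem_childChains hd' b
      simp only [ha, hb, glue_dotProduct_glue, smul_dotProduct, dotProduct_smul, hcd, smul_zero,
        add_zero]

theorem nodup_boolChains (n : ℕ) : (boolChains n).Nodup := by
  refine (pairwise_dotProduct_eq_zero_boolChains n).imp_of_mem fun {c d} hc _ hcd h => ?_
  obtain ⟨k, hk⟩ := exists_isSymmetricChain_of_mem_boolChains hc
  exact hk.isJordanString.ne_zero (dotProduct_self_eq_zero.1 (h ▸ hcd 0 0))

end SymmetricChains

section Normalize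

variable {α : Type*} [Fintype α]

/-- An integral vector, divided by its Euclidean length; the zero vector is sent to itself. -/
noncomputable def normalized (v : Finset α → ℤ) : Finset α → ℂ := fun X =>
  ((v X : ℝ) / √(∑ Y, (v Y : ℝ) ^ 2) : ℝ)

theorem cast_dotProduct_self (v : Finset α → ℤ) :
    ((v ⬝ᵥ v : ℤ) : ℝ) = ∑ Y, (v Y : ℝ) ^ 2 := by
  simp [dotProduct, sq]

theorem star_normalized_dotProduct (v w : Finset α → ℤ) :
    star (normalized v) ⬝ᵥ normalized w =
      (((v ⬝ᵥ w : ℤ) / (√(∑ Y, (v Y : ℝ) ^ 2) * √(∑ Y, (w Y : ℝ) ^ 2)) : ℝ) : ℂ) := by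
  simp only [dotProduct, normalized, Pi.star_apply, Complex.star_def, Complex.conj_ofReal]
  push_cast
  rw [sum_div]
  exact sum_congr rfl fun X _ => div_mul_div_comm _ _ _ _

theorem star_normalized_dotProduct_self {v : Finset α → ℤ} (hv : v ≠ 0) :
    star (normalized v) ⬝ᵥ normalized v = 1 := by
  have hpos : (v ⬝ᵥ v : ℤ) ≠ 0 := dotProduct_self_eq_zero.ne.2 hv
  rw [star_normalized_dotProduct, Real.mul_self_sqrt (by positivity), ← cast_dotProduct_self,
    div_self (Int.cast_ne_zero.2 hpos), Complex.ofReal_one]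

theorem isOfRank_normalized {v : Finset α → ℤ} {r : ℕ} (hv : IsOfRank v r) :
    IsOfRank (normalized v) r := by
  refine fun X hX => hv X fun h => hX ?_
  simp [normalized, h]

end Normalize

section BasisVectors

variable {n : ℕ} (σ : ChainOrder n)

/-- The chain of `O(n)` whose vectors have the indices `(k, b, i)`, for given `k` and `b`. -/
def chainAt (p : Σ k : Fin (n / 2 + 1), Fin (chainCount n k)) : List (Finset (Fin n) → ℤ) :=
  (chainsFrom n p.1).get (σ p.1 p.2)

theorem chainAt_mem (p : Σ k : Fin (n / 2 + 1), Fin (chainCount n k)) :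
    chainAt σ p ∈ boolChains n :=
  (mem_chainsFrom.1 (List.get_mem _ _)).1

theorem isSymmetricChain_chainAt (p : Σ k : Fin (n / 2 + 1), Fin (chainCount n k)) :
    IsSymmetricChain p.1 (chainAt σ p) :=
  (mem_chainsFrom.1 (List.get_mem _ _)).2

theorem isJordanString_chainAt (p : Σ k : Fin (n / 2 + 1), Fin (chainCount n k)) :
    IsJordanString p.1 (n - 2 * p.1) (chainSeq (chainAt σ p)) := by
  have h := isSymmetricChain_chainAt σ p
  rw [show n - 2 * (p.1 : ℕ) = (chainAt σ p).length - 1 by have := h.length_add; omega]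
  exact h.isJordanString

theorem chainAt_injective : Function.Injective (chainAt σ) := by
  rintro ⟨k, b⟩ ⟨k', b'⟩ h
  have hlen := (isSymmetricChain_chainAt σ ⟨k, b⟩).length_add
  have hlen' := (isSymmetricChain_chainAt σ ⟨k', b'⟩).length_add
  rw [h] at hlen
  obtain rfl : k = k' := Fin.ext (by dsimp only at hlen hlen'; omega)
  have hget := List.nodup_iff_injective_get.1 ((nodup_boolChains n).filter _) h
  exact congrArg _ ((σ k).injective hget)

theorem range_chainAt : Set.range (chainAt σ) = {c | c ∈ boolChains n} := by
  refine Set.Subset.antisymm (Set.range_subset_iff.2 (chainAt_mem σ)) fun c hc => ?_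
  obtain ⟨k, hk⟩ := exists_isSymmetricChain_of_mem_boolChains hc
  have hkn : k < n / 2 + 1 := by
    have hlen := hk.length_add
    have hpos := hk.length_pos
    omega
  obtain ⟨m, hm⟩ := List.get_of_mem (mem_chainsFrom.2 ⟨hc, hk⟩)
  exact ⟨⟨⟨k, hkn⟩, (σ ⟨k, hkn⟩).symm m⟩, by rw [chainAt, Equiv.apply_symm_apply, hm]⟩

theorem basisVec_eq_chainSeq (s : ChainIdx n) :
    basisVec σ s = chainSeq (chainAt σ ⟨s.1, s.2.1⟩) (s.2.2.1 - s.1) :=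
  rfl

theorem sub_lt_length_chainAt (s : ChainIdx n) :
    s.2.2.1 - s.1 < (chainAt σ ⟨s.1, s.2.1⟩).length := by
  have hi := mem_Icc.1 s.2.2.2
  have hlen := (isSymmetricChain_chainAt σ ⟨s.1, s.2.1⟩).length_add
  dsimp only at hlen
  omega

theorem hasRank_basisVec (s : ChainIdx n) : HasRank (basisVec σ s) s.2.2.1 := by
  have h := (isSymmetricChain_chainAt σ ⟨s.1, s.2.1⟩).hasRank (sub_lt_length_chainAt σ s)
  rwa [add_tsub_cancel_of_le (mem_Icc.1 s.2.2.2).1] at h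

theorem basisVec_dotProduct_basisVec {s s' : ChainIdx n} (h : s ≠ s') :
    basisVec σ s ⬝ᵥ basisVec σ s' = 0 := by
  by_cases hchain : chainAt σ ⟨s.1, s.2.1⟩ = chainAt σ ⟨s'.1, s'.2.1⟩
  · obtain ⟨k, b, i⟩ := s
    obtain ⟨k', b', i'⟩ := s'
    obtain ⟨rfl, hb⟩ := Sigma.mk.inj (chainAt_injective σ hchain)
    obtain rfl := eq_of_heq hb
    refine IsOfRank.dotProduct_eq_zero (hasRank_basisVec σ _).2 (hasRank_basisVec σ _).2 ?_
    exact fun hi => h (congrArg (fun i => (⟨k, b, i⟩ : ChainIdx n)) (Subtype.ext hi))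
  · have : Std.Symm fun c d : List (Finset (Fin n) → ℤ) =>
        ∀ a b, chainSeq c a ⬝ᵥ chainSeq d b = 0 :=
      ⟨fun c d hcd a b => (dotProduct_comm _ _).trans (hcd b a)⟩
    exact (pairwise_dotProduct_eq_zero_boolChains n).forall (chainAt_mem σ _) (chainAt_mem σ _)
      hchain _ _

theorem basisVec_injective : Function.Injective (basisVec σ) := by
  intro s s' h
  by_contra hne
  have horth := basisVec_dotProduct_basisVec σ hne
  rw [← h] at horth
  exact (hasRank_basisVec σ s).1 (dotProduct_self_eq_zero.1 horth)

theorem range_basisVec : Set.range (basisVec σ) = {v | ∃ c ∈ boolChains n, v ∈ c} := by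
  refine Set.Subset.antisymm (Set.range_subset_iff.2 fun s =>
    ⟨_, chainAt_mem σ ⟨s.1, s.2.1⟩, ?_⟩) ?_
  · rw [basisVec_eq_chainSeq, chainSeq, List.getD_eq_getElem _ _ (sub_lt_length_chainAt σ s)]
    exact List.getElem_mem _
  · rintro v ⟨c, hc, hv⟩
    obtain ⟨p, rfl⟩ : c ∈ Set.range (chainAt σ) := by rwa [range_chainAt]
    obtain ⟨a, ha, rfl⟩ := exists_chainSeq_eq_of_mem hv
    have hlen := (isSymmetricChain_chainAt σ p).length_add
    refine ⟨⟨p.1, p.2, p.1 + a, mem_Icc.2 ⟨by omega, by omega⟩⟩, ?_⟩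
    rw [basisVec_eq_chainSeq, Nat.add_sub_cancel_left]

theorem card_chainIdx (n : ℕ) : Fintype.card (ChainIdx n) = 2 ^ n := by
  let σ : ChainOrder n := fun k =>
    finCongr (length_chainsFrom (Nat.lt_succ_iff.1 k.2)).symm
  have hblock (p : Σ k : Fin (n / 2 + 1), Fin (chainCount n k)) :
      Fintype.card (BlockIdx n p.1) = (chainAt σ p).length := by
    have hlen := (isSymmetricChain_chainAt σ p).length_add
    rw [card_blockIdx (Nat.lt_succ_iff.1 p.1.2)]
    omega
  have himage : univ.image (chainAt σ) = (boolChains n).toFinset := by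
    ext c
    rw [List.mem_toFinset, mem_image_univ_iff_mem_range, range_chainAt]
    exact Iff.rfl
  calc Fintype.card (ChainIdx n)
      = ∑ p : Σ k : Fin (n / 2 + 1), Fin (chainCount n k), Fintype.card (BlockIdx n p.1) := by
        rw [Fintype.card_sigma, Fintype.sum_sigma]
        exact sum_congr rfl fun k _ => (Fintype.card_prod _ _).trans (sum_const _).symm
    _ = ∑ p, (chainAt σ p).length := sum_congr rfl fun p _ => hblock p
    _ = ∑ c ∈ (boolChains n).toFinset, c.length := by
        rw [← himage, sum_image (chainAt_injective σ).injOn]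
    _ = 2 ^ n := by rw [List.sum_toFinset _ (nodup_boolChains n), sum_length_boolChains]

theorem matNC_apply (X : Finset (Fin n)) (s : ChainIdx n) :
    matNC σ X s = normalized (basisVec σ s) X :=
  rfl

theorem conjTranspose_matNC_mul_self : (matNC σ)ᴴ * matNC σ = 1 := by
  ext s s'
  have hentry : ((matNC σ)ᴴ * matNC σ) s s' =
      star (normalized (basisVec σ s)) ⬝ᵥ normalized (basisVec σ s') :=
    rfl
  rw [hentry]
  rcases eq_or_ne s s' with rfl | hne
  · rw [star_normalized_dotProduct_self (hasRank_basisVec σ s).1, one_apply_eq]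
  · rw [star_normalized_dotProduct, basisVec_dotProduct_basisVec σ hne, one_apply_ne hne,
      Int.cast_zero, zero_div, Complex.ofReal_zero]

theorem matNC_mul_conjTranspose_self : matNC σ * (matNC σ)ᴴ = 1 := by
  refine (mul_eq_one_comm_of_card_eq _ _ _ ?_).1 (conjTranspose_matNC_mul_self σ)
  rw [card_chainIdx, Fintype.card_finset, Fintype.card_fin]

end BasisVectors

theorem IsOfRank.inclusionOp_eq_zero {α R : Type*} [CommRing R] [Fintype α] [DecidableEq α]
    {v : Finset α → R} {r u : ℕ} (hv : IsOfRank v r) (hu : r < u) : inclusionOp u v = 0 := by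
  ext Z
  rw [inclusionOp, Pi.zero_apply, ite_eq_right_iff]
  refine fun hZ => sum_eq_zero fun Y _ => ite_eq_right_iff.2 fun hZY => ?_
  by_contra hY
  have hcard := card_le_card hZY
  rw [hv Y hY] at hcard
  omega

section InclusionOfNormalized

variable {α : Type*} [Fintype α] [DecidableEq α]

theorem inclusionOp_normalized (u : ℕ) (v : Finset α → ℤ) :
    inclusionOp u (normalized v) =
      fun X => (((inclusionOp u v X : ℤ) / √(∑ Y, (v Y : ℝ) ^ 2) : ℝ) : ℂ) := by
  ext Z
  simp only [inclusionOp, normalized]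
  split_ifs
  · push_cast
    rw [sum_div]
    refine sum_congr rfl fun Y _ => ?_
    split_ifs <;> simp
  · simp

namespace IsJordanString

variable {k l : ℕ} {x : ℕ → Finset α → ℤ}

theorem sqrt_sum_sq (h : IsJordanString k l x) (a : ℕ) :
    √(∑ Y, (x a Y : ℝ) ^ 2) = a.factorial * √(l.choose a) * √(∑ Y, (x 0 Y : ℝ) ^ 2) := by
  have hself := congrArg (Int.cast (R := ℝ)) (h.dotProduct_self a)
  push_cast [cast_dotProduct_self] at hself
  rw [hself, Real.sqrt_mul (by positivity), Real.sqrt_mul (by positivity),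
    Real.sqrt_sq (Nat.cast_nonneg _)]

theorem inclusionOp_normalized_add (h : IsJordanString k l x) {b t : ℕ} (hbt : b + t ≤ l) :
    inclusionOp (k + b) (normalized (x (b + t))) =
      (((l - b).choose t * √(l.choose b) / √(l.choose (b + t)) : ℝ) : ℂ) • normalized (x b) := by
  have hfact : ((b + t).descFactorial t : ℝ) * b.factorial = (b + t).factorial := by
    have hnat := Nat.factorial_mul_descFactorial (Nat.le_add_left t b)
    rw [Nat.add_sub_cancel, mul_comm] at hnat
    exact_mod_cast hnat
  have hb : √(l.choose b) ≠ 0 := by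
    have := Nat.choose_pos (show b ≤ l by omega)
    positivity
  ext Z
  rw [inclusionOp_normalized, h.inclusionOp_add hbt, Pi.smul_apply, smul_eq_mul, normalized,
    ← Complex.ofReal_mul, h.sqrt_sum_sq b, h.sqrt_sum_sq (b + t), ← hfact]
  simp only [Pi.smul_apply, smul_eq_mul, Int.cast_mul, Int.cast_natCast, Nat.cast_mul]
  have hdesc : ((b + t).descFactorial t : ℝ) ≠ 0 :=
    Nat.cast_ne_zero.2 (Nat.descFactorial_pos.2 (Nat.le_add_left t b)).ne'
  field_simp

theorem inclusionOp_normalized_of_lt (h : IsJordanString k l x) {a u : ℕ} (ha : a ≤ l)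
    (hu : u < k) : inclusionOp u (normalized (x a)) = 0 := by
  rw [inclusionOp_normalized, h.inclusionOp_of_lt ha hu]
  ext X
  simp

end IsJordanString

end InclusionOfNormalized

section Blocks

variable {n : ℕ}

/-- The star algebra homomorphism `repeatBlocks`. -/
def repeatBlocksHom (n : ℕ) : BlockAlg n →⋆ₐ[ℂ] Matrix (ChainIdx n) (ChainIdx n) ℂ where
  toFun := repeatBlocks
  map_one' := by
    simp only [repeatBlocks, Pi.one_apply, one_kronecker_one]
    exact blockDiagonal'_one
  map_mul' B B' := by
    simp only [repeatBlocks, Pi.mul_apply, ← blockDiagonal'_mul, ← mul_kronecker_mul,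
      Matrix.one_mul]
  map_zero' := by
    simp only [repeatBlocks, Pi.zero_apply, kronecker_zero]
    exact blockDiagonal'_zero
  map_add' B B' := by
    simp only [repeatBlocks, Pi.add_apply, kronecker_add, ← blockDiagonal'_add, Pi.add_def]
  commutes' r := by
    simp only [repeatBlocks, Algebra.algebraMap_eq_smul_one, Pi.smul_apply, Pi.one_apply,
      kronecker_smul, one_kronecker_one]
    exact (blockDiagonal'_smul r _).trans (congrArg _ blockDiagonal'_one)
  map_star' B := by
    simp [repeatBlocks, star_eq_conjTranspose, blockDiagonal'_conjTranspose,
      conjTranspose_kronecker]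

theorem dropBlocks_repeatBlocks (B : BlockAlg n) : dropBlocks (repeatBlocks B) = B := by
  ext k i j
  simp [dropBlocks, repeatBlocks]

theorem matNC_mul_repeatBlocks_apply (σ : ChainOrder n) (B : BlockAlg n) (X : Finset (Fin n))
    (k : Fin (n / 2 + 1)) (b : Fin (chainCount n k)) (j : BlockIdx n k) :
    (matNC σ * repeatBlocks B) X ⟨k, b, j⟩ = ∑ r, matNC σ X ⟨k, b, r⟩ * B k r j := by
  rw [mul_apply, Fintype.sum_sigma, sum_eq_single_of_mem k (mem_univ k),
    Fintype.sum_prod_type, sum_eq_single_of_mem b (mem_univ b)]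
  · simp [repeatBlocks]
  · intro b' _ hb
    simp [repeatBlocks, hb]
  · intro k' _ hk
    simp [repeatBlocks, blockDiagonal'_apply_ne _ _ _ hk]

/-- The element of the block algebra with components `E_{i,j,k}`, where `E_{i,j,k} = 0` unless
`k ≤ i, j ≤ n - k`. -/
def blockUnit (n i j : ℕ) : BlockAlg n := fun _ =>
  Matrix.of fun r s => if (r : ℕ) = i ∧ (s : ℕ) = j then 1 else 0

theorem blockUnit_eq_single {i j : ℕ} {k : Fin (n / 2 + 1)} (hi : i ∈ Icc (k : ℕ) (n - k))
    (hj : j ∈ Icc (k : ℕ) (n - k)) :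
    blockUnit n i j k = Matrix.single (⟨i, hi⟩ : BlockIdx n k) (⟨j, hj⟩ : BlockIdx n k) 1 := by
  ext r s
  simp [blockUnit, single_apply, Subtype.ext_iff, eq_comm]

theorem blockUnit_eq_zero {i j : ℕ} {k : Fin (n / 2 + 1)}
    (h : ¬(i ∈ Icc (k : ℕ) (n - k) ∧ j ∈ Icc (k : ℕ) (n - k))) : blockUnit n i j k = 0 := by
  ext r s
  refine if_neg ?_
  rintro ⟨rfl, rfl⟩
  exact h ⟨r.2, s.2⟩

theorem conjTranspose_blockUnit_mul_blockUnit {u : ℕ} {k : Fin (n / 2 + 1)}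
    (hu : u ∈ Icc (k : ℕ) (n - k)) (i j : ℕ) :
    (blockUnit n u i k)ᴴ * blockUnit n u j k = blockUnit n i j k := by
  ext r s
  rw [mul_apply, sum_eq_single_of_mem ⟨u, hu⟩ (mem_univ _)]
  · simp [blockUnit, ← ite_and, and_comm]
  · intro q _ hq
    simp [blockUnit, show (q : ℕ) ≠ u from fun h => hq (Subtype.ext h)]

end Blocks

section BinomLemmas

theorem binom_natCast (a b : ℕ) : binom a b = a.choose b := by
  rw [binom, if_pos (Int.natCast_nonneg b), Int.toNat_natCast, Ring.choose_natCast]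

theorem binom_of_neg (a : ℤ) {b : ℤ} (hb : b < 0) : binom a b = 0 :=
  if_neg (not_le.2 hb)

/-- The summand with index `u` of `beta`, without the factors that depend on `t`. -/
def betaTerm (n i j k u : ℕ) : ℤ :=
  binom (n - 2 * k) (u - k) * binom (n - k - u) (i - u) * binom (n - k - u) (j - u)

theorem beta_eq_sum_betaTerm (n i j k t : ℕ) :
    beta n i j k t =
      ∑ u ∈ range (n + 1), (-1) ^ (u + t) * u.choose t * betaTerm n i j k u := by
  refine sum_congr rfl fun u _ => ?_
  rw [binom_natCast, betaTerm]
  ring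

theorem binom_sub_eq_choose {n k : ℕ} (hk : k ≤ n / 2) {u : ℕ} (hu : k ≤ u) :
    binom (n - 2 * k) (u - k) = (n - 2 * k).choose (u - k) := by
  rw [← binom_natCast]
  congr 1 <;> push_cast [hu, show 2 * k ≤ n by omega] <;> rfl

theorem betaTerm_eq_zero_of_lt (n i j : ℕ) {k u : ℕ} (hu : u < k) : betaTerm n i j k u = 0 := by
  rw [betaTerm, binom_of_neg _ (by omega), zero_mul, zero_mul]

theorem betaTerm_eq_zero_of_notMem {n k u : ℕ} (hk : k ≤ n / 2) (hu : u ∉ Icc k (n - k))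
    (i j : ℕ) : betaTerm n i j k u = 0 := by
  rcases lt_or_ge u k with h | h
  · exact betaTerm_eq_zero_of_lt n i j h
  · rw [betaTerm, binom_sub_eq_choose hk h,
      Nat.choose_eq_zero_of_lt (by rw [mem_Icc] at hu; omega), Nat.cast_zero, zero_mul, zero_mul]

theorem betaTerm_self_ne_zero {n k i j : ℕ} (hk : k ≤ n / 2) (hi : i ∈ Icc k (n - k))
    (hj : j ∈ Icc k (n - k)) : betaTerm n i j k k ≠ 0 := by
  rw [mem_Icc] at hi hj
  have hi' := (Nat.choose_pos (show i - k ≤ n - 2 * k by omega)).ne'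
  have hj' := (Nat.choose_pos (show j - k ≤ n - 2 * k by omega)).ne'
  rw [betaTerm, show (n : ℤ) - k - k = n - 2 * k by ring, binom_sub_eq_choose hk le_rfl,
    binom_sub_eq_choose hk hi.1, binom_sub_eq_choose hk hj.1, Nat.sub_self, Nat.choose_zero_right]
  exact_mod_cast mul_ne_zero (mul_ne_zero one_ne_zero hi') hj'

end BinomLemmas

section InclusionMatrices

variable {n : ℕ}

theorem matM_mulVec_of_isOfRank {v : Finset (Fin n) → ℂ} {r : ℕ} (hv : IsOfRank v r) (u j : ℕ) :
    matM n u j u *ᵥ v = if r = j then inclusionOp u v else 0 := by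
  have hterm (Z Y : Finset (Fin n)) : matM n u j u Z Y * v Y =
      if r = j ∧ #Z = u then if Z ⊆ Y then v Y else 0 else 0 := by
    rcases eq_or_ne (v Y) 0 with hY | hY
    · simp [hY]
    · rw [matM, of_apply, ite_mul, one_mul, zero_mul, hv Y hY, ← ite_and]
      refine if_congr ?_ rfl rfl
      rw [← inter_eq_left]
      refine ⟨fun ⟨h₁, h₂, h₃⟩ => ⟨⟨h₂, h₁⟩, ?_⟩, fun ⟨⟨h₁, h₂⟩, h₃⟩ => ⟨h₂, h₁, ?_⟩⟩
      · exact eq_of_subset_of_card_le inter_subset_left (h₁.trans h₃.symm).le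
      · rw [h₃, h₂]
  ext Z
  simp only [mulVec, dotProduct, hterm]
  by_cases hr : r = j <;> by_cases hZ : #Z = u <;> simp [inclusionOp, hr, hZ]

/-- The nonzero entry, in the `k`-th block, of the inclusion matrix `M^u_{u,j}` in the basis given
by the columns of `N(n)`. -/
noncomputable def inclusionCoeff (n u j k : ℕ) : ℝ :=
  binom (n - k - u) (j - u) * √((n - 2 * k).choose (u - k)) / √((n - 2 * k).choose (j - k))

theorem inclusionOp_normalized_basisVec_of_mem (σ : ChainOrder n) {k : Fin (n / 2 + 1)}
    (b : Fin (chainCount n k)) (j : BlockIdx n k) {u : ℕ} (hu : u ∈ Icc (k : ℕ) (n - k)) :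
    inclusionOp u (normalized (basisVec σ ⟨k, b, j⟩)) =
      (inclusionCoeff n u j k : ℂ) • normalized (basisVec σ ⟨k, b, u, hu⟩) := by
  obtain ⟨j, hj⟩ := j
  rcases lt_or_ge j u with h | h
  · have hrank := isOfRank_normalized (hasRank_basisVec σ ⟨k, b, j, hj⟩).2
    rw [hrank.inclusionOp_eq_zero h, inclusionCoeff, binom_of_neg _ (by dsimp only; omega)]
    simp
  · rw [mem_Icc] at hj
    obtain ⟨a, rfl⟩ := Nat.exists_eq_add_of_le (mem_Icc.1 hu).1
    obtain ⟨t, rfl⟩ := Nat.exists_eq_add_of_le h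
    have hbinom : binom (n - k - (k + a : ℕ)) ((k + a + t : ℕ) - (k + a : ℕ)) =
        (n - 2 * k - a).choose t := by
      rw [← binom_natCast]
      congr 1 <;> omega
    have hcoeff : inclusionCoeff n (k + a) (k + a + t) k = (n - 2 * k - a).choose t *
        √((n - 2 * k).choose a) / √((n - 2 * k).choose (a + t)) := by
      rw [inclusionCoeff, hbinom, Int.cast_natCast, Nat.add_assoc, Nat.add_sub_cancel_left,
        Nat.add_sub_cancel_left]
    have hup := (isJordanString_chainAt σ ⟨k, b⟩).inclusionOp_normalized_add (b := a) (t := t)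
      (by rw [mem_Icc] at hu; dsimp only; omega)
    rw [hcoeff]
    simpa only [basisVec_eq_chainSeq, Nat.add_assoc, Nat.add_sub_cancel_left] using hup

theorem inclusionOp_normalized_basisVec_of_notMem (σ : ChainOrder n) {k : Fin (n / 2 + 1)}
    (b : Fin (chainCount n k)) (j : BlockIdx n k) {u : ℕ} (hu : u ∉ Icc (k : ℕ) (n - k)) :
    inclusionOp u (normalized (basisVec σ ⟨k, b, j⟩)) = 0 := by
  obtain ⟨j, hj⟩ := j
  rw [mem_Icc] at hu
  rcases lt_or_ge u k with h | h
  · have hjk := mem_Icc.1 hj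
    exact (isJordanString_chainAt σ ⟨k, b⟩).inclusionOp_normalized_of_lt (by dsimp only; omega) h
  · have hrank := isOfRank_normalized (hasRank_basisVec σ ⟨k, b, j, hj⟩).2
    exact hrank.inclusionOp_eq_zero (by rw [mem_Icc] at hj; dsimp only; omega)

/-- The blocks of the inclusion matrix `M^u_{u,j}` in the basis given by the columns of `N(n)`. -/
noncomputable def inclusionBlocks (n u j : ℕ) : BlockAlg n := fun k =>
  (inclusionCoeff n u j k : ℂ) • blockUnit n u j k

theorem matM_mul_matNC (σ : ChainOrder n) (u j : ℕ) :
    matM n u j u * matNC σ = matNC σ * repeatBlocks (inclusionBlocks n u j) := by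
  ext X ⟨k, b, r⟩
  have hcol : (matM n u j u * matNC σ) X ⟨k, b, r⟩ =
      (matM n u j u *ᵥ normalized (basisVec σ ⟨k, b, r⟩)) X :=
    rfl
  rw [hcol, matM_mulVec_of_isOfRank (isOfRank_normalized (hasRank_basisVec σ _).2),
    matNC_mul_repeatBlocks_apply]
  simp only [inclusionBlocks, blockUnit, Matrix.smul_apply, of_apply, smul_eq_mul, matNC_apply]
  split_ifs with hr
  · obtain rfl : (r : ℕ) = j := hr
    by_cases hu : u ∈ Icc (k : ℕ) (n - k)
    · rw [inclusionOp_normalized_basisVec_of_mem σ b r hu,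
        sum_eq_single_of_mem (⟨u, hu⟩ : BlockIdx n k) (mem_univ _)
          fun q _ hq => by simp [show (q : ℕ) ≠ u from fun h => hq (Subtype.ext h)]]
      simp [mul_comm]
    · rw [inclusionOp_normalized_basisVec_of_notMem σ b r hu]
      refine (sum_eq_zero fun q _ => ?_).symm
      simp [show (q : ℕ) ≠ u from fun h => hu (h ▸ q.2)]
  · simp only [hr, and_false, if_false, mul_zero, sum_const_zero, Pi.zero_apply]

end InclusionMatrices

section InclusionGram

variable {n : ℕ}

/-- The Gram product of the inclusion matrices of the `u`-subsets against the `i`-subsets and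
against the `j`-subsets. -/
def inclusionGram (n i j u : ℕ) : Matrix (Finset (Fin n)) (Finset (Fin n)) ℂ :=
  (matM n u i u)ᴴ * matM n u j u

theorem inclusionGram_mem (n i j u : ℕ) : inclusionGram n i j u ∈ terwilliger n :=
  mul_mem (star_mem (matM_mem n u i u)) (matM_mem n u j u)

theorem inclusionGram_apply (i j u : ℕ) (X Y : Finset (Fin n)) :
    inclusionGram n i j u X Y = if #X = i ∧ #Y = j then ((#(X ∩ Y)).choose u : ℂ) else 0 := by
  have hterm (Z : Finset (Fin n)) : star (matM n u i u Z X) * matM n u j u Z Y =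
      if #X = i ∧ #Y = j then if Z ∈ powersetCard u (X ∩ Y) then 1 else 0 else 0 := by
    have hmem : Z ∈ powersetCard u (X ∩ Y) ↔ #Z = u ∧ #(Z ∩ X) = u ∧ #(Z ∩ Y) = u := by
      rw [mem_powersetCard, subset_inter_iff, ← inter_eq_left, ← inter_eq_left]
      refine ⟨?_, ?_⟩
      · rintro ⟨⟨hX, hY⟩, hZ⟩
        exact ⟨hZ, by rw [hX, hZ], by rw [hY, hZ]⟩
      · rintro ⟨hZ, hX, hY⟩
        exact ⟨⟨eq_of_subset_of_card_le inter_subset_left (hZ.trans hX.symm).le,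
          eq_of_subset_of_card_le inter_subset_left (hZ.trans hY.symm).le⟩, hZ⟩
    simp only [hmem, matM, of_apply, apply_ite star, star_one, star_zero, ← ite_and, mul_ite,
      mul_one, mul_zero]
    exact if_congr (by tauto) rfl rfl
  simp only [inclusionGram, mul_apply, conjTranspose_apply, hterm]
  split_ifs
  · rw [sum_boole, filter_mem_eq_inter, univ_inter, card_powersetCard]
  · exact sum_const_zero

theorem matM_eq_sum_inclusionGram (n i j t : ℕ) :
    matM n i j t = ∑ u ∈ range (n + 1),
      (((-1) ^ (u + t) * u.choose t : ℤ) : ℂ) • inclusionGram n i j u := by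
  ext X Y
  simp only [Matrix.sum_apply, Matrix.smul_apply, inclusionGram_apply, smul_eq_mul]
  rw [matM, of_apply]
  by_cases hij : #X = i ∧ #Y = j
  · have hcard : #(X ∩ Y) ≤ n := card_finset_fin_le _
    have hinv := congrArg (Int.cast (R := ℂ)) (sum_alternating_choose_mul_choose hcard t)
    push_cast at hinv ⊢
    simp only [hij, true_and, if_true, hinv]
  · simp only [hij, if_false, mul_zero, sum_const_zero, ← and_assoc, false_and]

theorem eq_sum_matM_of_mem_terwilliger {M : Matrix (Finset (Fin n)) (Finset (Fin n)) ℂ}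
    (hM : M ∈ terwilliger n) :
    ∃ f : ℕ × ℕ × ℕ → ℂ, M = ∑ p ∈ range (n + 1) ×ˢ range (n + 1) ×ˢ range (n + 1),
      f p • matM n p.1 p.2.1 p.2.2 := by
  let type (P : Finset (Fin n) × Finset (Fin n)) : ℕ × ℕ × ℕ := (#P.1, #P.2, #(P.1 ∩ P.2))
  have hfactors : (fun P : Finset (Fin n) × Finset (Fin n) => M P.1 P.2).FactorsThrough type := by
    rintro ⟨X, Y⟩ ⟨X', Y'⟩ h
    simp only [type, Prod.mk.injEq] at h
    obtain ⟨π, rfl, rfl⟩ := exists_perm_map_eq_map_eq h.1 h.2.1 h.2.2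
    exact (hM π X Y).symm
  refine ⟨Function.extend type (fun P => M P.1 P.2) 0, ?_⟩
  ext X Y
  have hmem : type (X, Y) ∈ range (n + 1) ×ˢ range (n + 1) ×ˢ range (n + 1) := by
    simp only [type, mem_product, mem_range, Nat.lt_succ_iff]
    exact ⟨card_finset_fin_le _, card_finset_fin_le _, card_finset_fin_le _⟩
  rw [Matrix.sum_apply, sum_eq_single_of_mem _ hmem]
  · rw [Matrix.smul_apply, hfactors.extend_apply]
    simp [matM, type]
  · intro p _ hp
    rw [Matrix.smul_apply, matM, of_apply, if_neg, smul_zero]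
    exact fun h => hp (Prod.ext h.1.symm (Prod.ext h.2.1.symm h.2.2.symm))

theorem terwilliger_eq_span_inclusionGram (n : ℕ) :
    Subalgebra.toSubmodule (terwilliger n).toSubalgebra =
      Submodule.span ℂ (Set.range fun p : ℕ × ℕ × ℕ => inclusionGram n p.1 p.2.1 p.2.2) := by
  refine le_antisymm (fun M hM => ?_) (Submodule.span_le.2 ?_)
  · obtain ⟨f, rfl⟩ := eq_sum_matM_of_mem_terwilliger hM
    refine Submodule.sum_mem _ fun p _ => Submodule.smul_mem _ _ ?_
    rw [matM_eq_sum_inclusionGram]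
    exact Submodule.sum_mem _ fun u _ =>
      Submodule.smul_mem _ _ (Submodule.subset_span ⟨(p.1, p.2.1, u), rfl⟩)
  · rintro _ ⟨p, rfl⟩
    exact inclusionGram_mem n p.1 p.2.1 p.2.2

/-- The nonzero entry, in the `k`-th block, of `inclusionGram n i j u` in the basis given by the
columns of `N(n)`. -/
noncomputable def gramCoeff (n i j u k : ℕ) : ℝ :=
  betaTerm n i j k u / (√((n - 2 * k).choose (i - k)) * √((n - 2 * k).choose (j - k)))

/-- The blocks of `inclusionGram n i j u` in the basis given by the columns of `N(n)`. -/
noncomputable def gramBlocks (n i j u : ℕ) : BlockAlg n := fun k =>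
  (gramCoeff n i j u k : ℂ) • blockUnit n i j k

theorem gramCoeff_self_ne_zero {n k i j : ℕ} (hk : k ≤ n / 2) (hi : i ∈ Icc k (n - k))
    (hj : j ∈ Icc k (n - k)) : gramCoeff n i j k k ≠ 0 := by
  have hterm := betaTerm_self_ne_zero hk hi hj
  rw [mem_Icc] at hi hj
  have hi' := Nat.choose_pos (show i - k ≤ n - 2 * k by omega)
  have hj' := Nat.choose_pos (show j - k ≤ n - 2 * k by omega)
  rw [gramCoeff]
  positivity

theorem inclusionCoeff_mul_inclusionCoeff {n k u : ℕ} (hk : k ≤ n / 2) (hu : k ≤ u) (i j : ℕ) :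
    inclusionCoeff n u i k * inclusionCoeff n u j k = gramCoeff n i j u k := by
  have hsqrt := Real.mul_self_sqrt (Nat.cast_nonneg (α := ℝ) ((n - 2 * k).choose (u - k)))
  rw [inclusionCoeff, inclusionCoeff, gramCoeff, betaTerm, binom_sub_eq_choose hk hu,
    div_mul_div_comm, mul_mul_mul_comm, hsqrt]
  push_cast
  ring

theorem star_inclusionBlocks_mul_inclusionBlocks (n i j u : ℕ) :
    star (inclusionBlocks n u i) * inclusionBlocks n u j = gramBlocks n i j u := by
  ext1 k
  have hk := Nat.lt_succ_iff.1 k.2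
  simp only [Pi.mul_apply, Pi.star_apply, inclusionBlocks, gramBlocks, star_eq_conjTranspose,
    conjTranspose_smul, Matrix.smul_mul, Matrix.mul_smul, smul_smul, Complex.star_def,
    Complex.conj_ofReal]
  by_cases hu : u ∈ Icc (k : ℕ) (n - k)
  · rw [conjTranspose_blockUnit_mul_blockUnit hu, ← Complex.ofReal_mul, mul_comm,
      ← inclusionCoeff_mul_inclusionCoeff hk (mem_Icc.1 hu).1]
  · rw [blockUnit_eq_zero fun h => hu h.1, conjTranspose_zero, Matrix.zero_mul, smul_zero,
      gramCoeff, betaTerm_eq_zero_of_notMem hk hu]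
    simp

theorem single_blockUnit_mem_span_gramBlocks (i j : ℕ) (k : Fin (n / 2 + 1)) :
    Pi.single k (blockUnit n i j k) ∈
      Submodule.span ℂ (Set.range fun p : ℕ × ℕ × ℕ => gramBlocks n p.1 p.2.1 p.2.2) := by
  refine mem_of_triangular_sum_mem _ (c := fun u k : Fin (n / 2 + 1) => (gramCoeff n i j u k : ℂ))
    (v := fun k : Fin (n / 2 + 1) => Pi.single k (blockUnit n i j k))
    (fun u k hu => ?_) (fun k hk => ?_) (fun u => ?_) k
  · simp [gramCoeff, betaTerm_eq_zero_of_lt n i j (Fin.lt_def.1 hu)]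
  · rw [blockUnit_eq_zero fun h => ?_, Pi.single_zero]
    exact gramCoeff_self_ne_zero (Nat.lt_succ_iff.1 k.2) h.1 h.2 (Complex.ofReal_eq_zero.1 hk)
  · have hgram : ∑ k : Fin (n / 2 + 1), (gramCoeff n i j u k : ℂ) •
        (Pi.single k (blockUnit n i j k) : BlockAlg n) = gramBlocks n i j u := by
      simp only [← Pi.single_smul]
      exact univ_sum_single (gramBlocks n i j u)
    exact hgram ▸ Submodule.subset_span ⟨(i, j, u), rfl⟩

theorem span_gramBlocks (n : ℕ) :
    Submodule.span ℂ (Set.range fun p : ℕ × ℕ × ℕ => gramBlocks n p.1 p.2.1 p.2.2) = ⊤ := by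
  refine eq_top_iff.2 fun B _ => ?_
  rw [← univ_sum_single B]
  refine Submodule.sum_mem _ fun k _ => ?_
  have hblock : B k = ∑ r : BlockIdx n k, ∑ s : BlockIdx n k, B k r s • blockUnit n r s k := by
    simp only [blockUnit_eq_single (Subtype.prop _) (Subtype.prop _), smul_single, smul_eq_mul,
      mul_one]
    exact matrix_eq_sum_single (B k)
  have hsingle : LinearMap.single ℂ _ k (B k) ∈
      Submodule.span ℂ (Set.range fun p : ℕ × ℕ × ℕ => gramBlocks n p.1 p.2.1 p.2.2) := by
    rw [hblock]
    simp only [map_sum, map_smul]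
    exact Submodule.sum_mem _ fun r _ => Submodule.sum_mem _ fun s _ =>
      Submodule.smul_mem _ _ (single_blockUnit_mem_span_gramBlocks r s k)
  exact hsingle

end InclusionGram

section BlockDiagonalization

variable {n : ℕ} (σ : ChainOrder n)

/-- Conjugation by `N(n)` as a homomorphism of star algebras. -/
noncomputable def conjHom :
    Matrix (Finset (Fin n)) (Finset (Fin n)) ℂ →⋆ₐ[ℂ] Matrix (ChainIdx n) (ChainIdx n) ℂ :=
  unitaryConj (matNC σ) (conjTranspose_matNC_mul_self σ) (matNC_mul_conjTranspose_self σ)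

theorem conjHom_matM (u j : ℕ) :
    conjHom σ (matM n u j u) = repeatBlocksHom n (inclusionBlocks n u j) := by
  calc (matNC σ)ᴴ * matM n u j u * matNC σ
      = (matNC σ)ᴴ * matNC σ * repeatBlocks (inclusionBlocks n u j) := by
        rw [Matrix.mul_assoc, matM_mul_matNC, Matrix.mul_assoc]
    _ = repeatBlocks (inclusionBlocks n u j) := by
        rw [conjTranspose_matNC_mul_self, Matrix.one_mul]

theorem conjHom_inclusionGram (i j u : ℕ) :
    conjHom σ (inclusionGram n i j u) = repeatBlocksHom n (gramBlocks n i j u) := by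
  rw [inclusionGram, ← star_eq_conjTranspose, map_mul, map_star, conjHom_matM, conjHom_matM,
    ← map_star, ← map_mul, star_inclusionBlocks_mul_inclusionBlocks]

theorem image_conjN_terwilliger :
    conjN σ '' (terwilliger n : Set (Matrix (Finset (Fin n)) (Finset (Fin n)) ℂ)) =
      Set.range (repeatBlocks (n := n)) := by
  have hmap : (Subalgebra.toSubmodule (terwilliger n).toSubalgebra).map
      (conjHom σ).toAlgHom.toLinearMap =
        LinearMap.range (repeatBlocksHom n).toAlgHom.toLinearMap := by
    rw [terwilliger_eq_span_inclusionGram, Submodule.map_span, LinearMap.range_eq_map,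
      ← span_gramBlocks, Submodule.map_span, ← Set.range_comp, ← Set.range_comp]
    congr 2
    exact funext fun p => conjHom_inclusionGram σ p.1 p.2.1 p.2.2
  exact congrArg SetLike.coe hmap

theorem exists_starAlgEquiv_eq_Phi :
    ∃ Ψ : terwilliger n ≃⋆ₐ[ℂ] BlockAlg n, ∀ M : terwilliger n, Ψ M = Phi σ M.1 := by
  have hinj : Function.Injective (repeatBlocksHom n) :=
    Function.LeftInverse.injective (g := dropBlocks) dropBlocks_repeatBlocks
  have hconj : Function.Injective ((conjHom σ).comp (terwilliger n).subtype) :=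
    (unitaryConj_injective (conjTranspose_matNC_mul_self σ)
      (matNC_mul_conjTranspose_self σ)).comp Subtype.val_injective
  obtain ⟨Ψ, hΨ⟩ := exists_starAlgEquiv_of_range_eq hconj hinj <| by
    have himage := image_conjN_terwilliger σ
    rw [Set.image_eq_range] at himage
    exact himage
  refine ⟨Ψ, fun M => ?_⟩
  rw [← dropBlocks_repeatBlocks (Ψ M)]
  exact congrArg dropBlocks (hΨ M)

theorem Phi_matM (i j t : ℕ) :
    Phi σ (matM n i j t) = ∑ u ∈ range (n + 1),
      (((-1) ^ (u + t) * u.choose t : ℤ) : ℂ) • gramBlocks n i j u := by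
  have hconj : conjHom σ (matM n i j t) = repeatBlocksHom n (∑ u ∈ range (n + 1),
      (((-1) ^ (u + t) * u.choose t : ℤ) : ℂ) • gramBlocks n i j u) := by
    simp only [matM_eq_sum_inclusionGram n i j t, map_sum, map_smul, conjHom_inclusionGram]
  exact (congrArg dropBlocks hconj).trans (dropBlocks_repeatBlocks _)

theorem Phi_matM_apply (i j t : ℕ) (k : Fin (n / 2 + 1)) :
    Phi σ (matM n i j t) k =
      ((((n - 2 * k : ℕ).choose (i - k) : ℝ) ^ (-(1 / 2) : ℝ) *
        ((n - 2 * k : ℕ).choose (j - k) : ℝ) ^ (-(1 / 2) : ℝ) *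
        (beta n i j k t : ℝ) : ℝ) : ℂ) • blockUnit n i j k := by
  have hcoeff (u : ℕ) : gramCoeff n i j u k =
      ((n - 2 * k : ℕ).choose (i - k) : ℝ) ^ (-(1 / 2) : ℝ) *
        ((n - 2 * k : ℕ).choose (j - k) : ℝ) ^ (-(1 / 2) : ℝ) * betaTerm n i j k u := by
    rw [Real.rpow_neg (Nat.cast_nonneg _), Real.rpow_neg (Nat.cast_nonneg _),
      ← Real.sqrt_eq_rpow, ← Real.sqrt_eq_rpow, gramCoeff]
    field_simp
  simp only [Phi_matM, Finset.sum_apply, Pi.smul_apply, gramBlocks, smul_smul, ← sum_smul, hcoeff]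
  congr 1
  rw [beta_eq_sum_betaTerm]
  push_cast
  rw [mul_sum]
  exact sum_congr rfl fun u _ => by ring

end BlockDiagonalization

theorem theorem4 (n : ℕ) :
    -- the number of chains of `O(n)` from rank `k` to rank `n - k` is `q_k`
    (∀ k : Fin (n / 2 + 1), (chainsFrom n k).length = chainCount n k) ∧
    -- and for every ordering of these chains
    ∀ σ : ChainOrder n,
      -- the vectors of `O(n)` are indexed bijectively, and by their ranks
      (Function.Injective (basisVec σ) ∧
        Set.range (basisVec σ) = {v | ∃ c ∈ boolChains n, v ∈ c} ∧
        ∀ s : ChainIdx n, HasRank (basisVec σ s) s.2.2.1) ∧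
      -- `N(n)` is unitary
      ((matNC σ).conjTranspose * matNC σ = 1 ∧ matNC σ * (matNC σ).conjTranspose = 1) ∧
      -- conjugation by `N(n)` block diagonalizes the Terwilliger algebra
      (conjN σ '' (terwilliger n : Set (Matrix (Finset (Fin n)) (Finset (Fin n)) ℂ)) =
        Set.range (repeatBlocks (n := n))) ∧
      -- `Φ` is an isomorphism of star algebras
      (∃ Ψ : terwilliger n ≃⋆ₐ[ℂ] BlockAlg n,
        ∀ M : terwilliger n, Ψ M = Phi σ M.1) ∧
      -- the images of the matrices `M^t_{i,j}`
      ∀ i j t : ℕ, i ≤ n → j ≤ n → t ≤ n → ∀ k : Fin (n / 2 + 1),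
        Phi σ (matM n i j t) k =
          if h : i ∈ Finset.Icc (k : ℕ) (n - k) ∧ j ∈ Finset.Icc (k : ℕ) (n - k) then
            ((((n - 2 * k : ℕ).choose (i - k) : ℝ) ^ (-(1 / 2) : ℝ) *
              ((n - 2 * k : ℕ).choose (j - k) : ℝ) ^ (-(1 / 2) : ℝ) *
              (beta n i j k t : ℝ) : ℝ) : ℂ) •
              Matrix.single (⟨i, h.1⟩ : BlockIdx n k) (⟨j, h.2⟩ : BlockIdx n k) (1 : ℂ)
          else 0 := by
  refine ⟨fun k => length_chainsFrom (Nat.lt_succ_iff.1 k.2), fun σ =>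
    ⟨⟨basisVec_injective σ, range_basisVec σ, hasRank_basisVec σ⟩,
      ⟨conjTranspose_matNC_mul_self σ, matNC_mul_conjTranspose_self σ⟩,
      image_conjN_terwilliger σ, exists_starAlgEquiv_eq_Phi σ, fun i j t _ _ _ k => ?_⟩⟩
  rw [Phi_matM_apply]
  split_ifs with h
  · rw [blockUnit_eq_single h.1 h.2]
  · rw [blockUnit_eq_zero h, smul_zero]
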